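/- A *variety of monoids* is a class of monoids closed under homomorphic images, submonoids and arbitrary direct products; varieties are ordered by inclusion, and $\mathbb{U}\vee\mathbb{V}$ denotes the smallest variety containing $\mathbb{U}$ and $\mathbb{V}$. For a semigroup $S$ without identity element, $S^1$ is the monoid obtained from $S$ by adjoining an identity element. Consider the semigroups (the first two with zero element $0$) $$E=\langle a,b,c \mid a^2=ab=0,\ ba=ca=a,\ b^2=bc=b,\ c^2=cb=c\rangle,$$ $$Q=\langle a,b,c \mid a^2=a,\ ab=b,\ ca=c,\ ac=ba=cb=0\rangle,$$ $$L_2=\langle a,b \mid a^2=ab=a,\ b^2=ba=b\rangle$$ of orders five, five and two, and let $\mathbb{E}^1,\mathbb{Q}^1,\mathbb{L}_2^1$ be the varieties of monoids generated by $E^1,Q^1,L_2^1$, respectively. For an identity $\sigma$, let $\mathbb{E}^1\{\sigma\}$ denote the class of all monoids in $\mathbb{E}^1$ that satisfy $\sigma$. For $n\ge 1$ let $\sigma_n$ be the identity $$\Big(\prod_{i=1}^n \mathbf{e}_ih_i\Big)x^2y^2\approx\Big(\prod_{i=1}^n \mathbf{e}_ih_i\Big)y^2x^2,\qquad \mathbf{e}_i=\begin{cases}x^2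 & (i \text{ odd}),\\ y^2 & (i\text{ even}),\end{cases}$$ where $x,y,h_1,h_2,\ldots$ are distinct variables, and let $\sigma_\infty$ be the identity $x^2y^2hx^2y^2\approx x^2y^2hy^2x^2$, where $x,y,h$ are distinct variables. **Proposition.** The varieties $\mathbb{V}$ with $\mathbb{L}_2^1\vee\mathbb{Q}^1\subseteq\mathbb{V}\subseteq\mathbb{E}^1$ are precisely $\mathbb{E}^1\{\sigma_n\}$ ($n\ge 1$), $\mathbb{E}^1\{\sigma_\infty\}$ and $\mathbb{E}^1$, and they form the strictly increasing chain $$\mathbb{E}^1\{\sigma_1\}\subset\mathbb{E}^1\{\sigma_2\}\subset\cdots\subset\mathbb{E}^1\{\sigma_\infty\}\subset\mathbb{E}^1,$$ that is, $\mathbb{E}^1\{\sigma_n\}\subsetneq\mathbb{E}^1\{\sigma_{n+1}\}$ and $\mathbb{E}^1\{\sigma_n\}\subsetneq\mathbb{E}^1\{\sigma_\infty\}$ for all $n\ge1$, and $\mathbb{E}^1\{\sigma_\infty\}\subsetneq\mathbb{E}^1$. In particular, $\mathbb{L}_2^1\vee\mathbb{Q}^1=\mathbb{E}^1\{\sigma_1\}$.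 -/

import Mathlib

universe u

/-- A variety of monoids: a class of monoids (in a fixed universe) closed under homomorphic
images, submonoids and arbitrary direct products (the empty product included). -/
@[ext]
structure MonoidVariety where
  Mem : ∀ (M : Type u) [Monoid M], Prop
  image : ∀ {M N : Type u} [Monoid M] [Monoid N] (f : M →* N),
    Function.Surjective f → Mem M → Mem N
  submonoid : ∀ {M : Type u} [Monoid M] (S : Submonoid M), Mem M → Mem S
  pi : ∀ {ι : Type u} (M : ι → Type u) [∀ i, Monoid (M i)],
    (∀ i, Mem (M i)) → Mem (∀ i, M i)

namespace MonoidVariety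

/-- Varieties are ordered by inclusion. -/
instance : PartialOrder MonoidVariety.{u} where
  le V W := ∀ (M : Type u) [Monoid M], V.Mem M → W.Mem M
  le_refl _ _ _ h := h
  le_trans _ _ _ h₁ h₂ M _ h := h₂ M (h₁ M h)
  le_antisymm V W h₁ h₂ := by
    ext M inst
    exact ⟨h₁ M, h₂ M⟩

/-- The intersection of a family of varieties. -/
instance : InfSet MonoidVariety.{u} where
  sInf S :=
    { Mem := fun M _ => ∀ V ∈ S, V.Mem M
      image := fun f hf h V hV => V.image f hf (h V hV)
      submonoid := fun T h V hV => V.submonoid T (h V hV)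
      pi := fun M _ h V hV => V.pi M fun i => h i V hV }

theorem isGLB_sInf (S : Set MonoidVariety.{u}) : IsGLB S (sInf S) :=
  ⟨fun V hV _ _ h => h V hV, fun _ hW M _ h _ hV => hW hV M h⟩

/-- Varieties of monoids form a complete lattice under inclusion. The join `V ⊔ W` is the
smallest variety containing both `V` and `W`. -/
instance : CompleteLattice MonoidVariety.{u} :=
  completeLatticeOfInf MonoidVariety.{u} isGLB_sInf

/-- The variety generated by a monoid: the smallest variety containing it. -/
def generatedBy (M : Type u) [Monoid M] : MonoidVariety.{u} :=
  sInf {V | V.Mem M}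

end MonoidVariety

/-- Words over the countably infinite alphabet of variables indexed by `ℕ`. -/
abbrev Word := FreeMonoid ℕ

/-- An identity `lhs ≈ rhs` between two words. -/
structure WordIdentity where
  lhs : Word
  rhs : Word

/-- A monoid satisfies an identity if both sides agree under every substitution. -/
def WordIdentity.SatisfiedBy (p : WordIdentity) (M : Type u) [Monoid M] : Prop :=
  ∀ θ : ℕ → M, FreeMonoid.lift θ p.lhs = FreeMonoid.lift θ p.rhs

theorem WordIdentity.SatisfiedBy.image {p : WordIdentity} {M N : Type u} [Monoid M] [Monoid N]
    (f : M →* N) (hf : Function.Surjective f) (h : p.SatisfiedBy M) : p.SatisfiedBy N := by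
  intro θ
  choose g hg using hf
  have key : FreeMonoid.lift θ = f.comp (FreeMonoid.lift fun n => g (θ n)) := by
    ext n
    simp [hg]
  rw [key, MonoidHom.comp_apply, MonoidHom.comp_apply, h]

theorem WordIdentity.SatisfiedBy.of_injective {p : WordIdentity} {M N : Type u} [Monoid M]
    [Monoid N] (f : M →* N) (hf : Function.Injective f) (h : p.SatisfiedBy N) :
    p.SatisfiedBy M := by
  intro θ
  apply hf
  have key : f.comp (FreeMonoid.lift θ) = FreeMonoid.lift fun n => f (θ n) := by
    ext n
    simp
  rw [← MonoidHom.comp_apply, ← MonoidHom.comp_apply, key, h]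

theorem WordIdentity.SatisfiedBy.pi {p : WordIdentity} {ι : Type u} (M : ι → Type u)
    [∀ i, Monoid (M i)] (h : ∀ i, p.SatisfiedBy (M i)) : p.SatisfiedBy (∀ i, M i) := by
  intro θ
  funext i
  have key : (Pi.evalMonoidHom M i).comp (FreeMonoid.lift θ)
      = FreeMonoid.lift fun n => θ n i := by
    ext n
    simp
  have := h i fun n => θ n i
  rw [← key] at this
  exact this

/-- The subvariety of `V` defined within `V` by a set of identities. -/
def MonoidVariety.definedBy (V : MonoidVariety.{u}) (Γ : Set WordIdentity) :
    MonoidVariety.{u} where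
  Mem M _ := V.Mem M ∧ ∀ p ∈ Γ, p.SatisfiedBy M
  image f hf h := ⟨V.image f hf h.1, fun p hp => (h.2 p hp).image f hf⟩
  submonoid S h := ⟨V.submonoid S h.1,
    fun p hp => (h.2 p hp).of_injective S.subtype Subtype.val_injective⟩
  pi M _ h := ⟨V.pi M fun i => (h i).1,
    fun p hp => WordIdentity.SatisfiedBy.pi M fun i => (h i).2 p hp⟩

/-- The semigroup `⟨a, b, c ∣ a² = ab = 0, ba = ca = a, b² = bc = b, c² = cb = c⟩` of order
five. -/
inductive SemigroupE : Type u
  | zero | a | ac | b | c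

/-- Multiplication table of `SemigroupE`. -/
def SemigroupE.mul : SemigroupE.{u} → SemigroupE.{u} → SemigroupE.{u}
  | .a, .c => .ac
  | .ac, .b => .ac
  | .ac, .c => .ac
  | .b, .a => .a
  | .b, .ac => .ac
  | .b, .b => .b
  | .b, .c => .b
  | .c, .a => .a
  | .c, .ac => .ac
  | .c, .b => .c
  | .c, .c => .c
  | _, _ => .zero

instance : Semigroup SemigroupE.{u} where
  mul := SemigroupE.mul
  mul_assoc x y z := by cases x <;> cases y <;> cases z <;> rfl

/-- The semigroup `⟨a, b, c ∣ a² = a, ab = b, ca = c, ac = ba = cb = 0⟩` of order five. -/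
inductive SemigroupQ : Type u
  | zero | a | b | c | bc

/-- Multiplication table of `SemigroupQ`. -/
def SemigroupQ.mul : SemigroupQ.{u} → SemigroupQ.{u} → SemigroupQ.{u}
  | .a, .a => .a
  | .a, .b => .b
  | .a, .bc => .bc
  | .b, .c => .bc
  | .c, .a => .c
  | .bc, .a => .bc
  | _, _ => .zero

instance : Semigroup SemigroupQ.{u} where
  mul := SemigroupQ.mul
  mul_assoc x y z := by cases x <;> cases y <;> cases z <;> rfl

/-- The left-zero semigroup `⟨a, b ∣ a² = ab = a, b² = ba = b⟩` of order two. -/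
inductive SemigroupL₂ : Type u
  | a | b

instance : Semigroup SemigroupL₂.{u} where
  mul x _ := x
  mul_assoc _ _ _ := rfl

/-- The variety generated by `E¹`, the semigroup `E` with an identity element adjoined. -/
def varietyE : MonoidVariety.{u} := MonoidVariety.generatedBy (WithOne SemigroupE.{u})

/-- The variety generated by `Q¹`. -/
def varietyQ : MonoidVariety.{u} := MonoidVariety.generatedBy (WithOne SemigroupQ.{u})

/-- The variety generated by `L₂¹`. -/
def varietyL₂ : MonoidVariety.{u} := MonoidVariety.generatedBy (WithOne SemigroupL₂.{u})

namespace Word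

/-- The variable `x`. -/
def x : Word := FreeMonoid.of 0

/-- The variable `y`. -/
def y : Word := FreeMonoid.of 1

/-- The variables `h 1, h 2, …`, distinct from each other and from `x` and `y`. -/
def h (i : ℕ) : Word := FreeMonoid.of (i + 1)

/-- `e i` is `x²` for odd `i` and `y²` for even `i`. -/
def e (i : ℕ) : Word := if Odd i then x ^ 2 else y ^ 2

/-- The product `e₁h₁ · e₂h₂ ⋯ eₙhₙ`. -/
def sigmaPrefix (n : ℕ) : Word := ((List.range' 1 n).map fun i => e i * h i).prod

end Word

open Word in
/-- The identity `σₙ : (e₁h₁ ⋯ eₙhₙ) x²y² ≈ (e₁h₁ ⋯ eₙhₙ) y²x²` (for `n ≥ 1`). -/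
def sigma (n : ℕ) : WordIdentity where
  lhs := sigmaPrefix n * (x ^ 2 * y ^ 2)
  rhs := sigmaPrefix n * (y ^ 2 * x ^ 2)

open Word in
/-- The identity `σ_∞ : x²y² h x²y² ≈ x²y² h y²x²`. -/
def sigmaInf : WordIdentity where
  lhs := x ^ 2 * y ^ 2 * h 1 * (x ^ 2 * y ^ 2)
  rhs := x ^ 2 * y ^ 2 * h 1 * (y ^ 2 * x ^ 2)

/-! Call a letter simple in a word if it occurs exactly once; simple letters cut a word into blocks.
In `E¹` the ideal `{0, a, ac}` has square zero and its complement `{1, b, c}` satisfies `pqp = pq`.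
Hence a non-simple letter may be repeated freely later in its block (`RepeatsLetters`), and only the
order of first occurrences inside each block carries further information.

Let `V` lie in the interval. Since `V` contains `Q¹`, the two sides of an identity of `V` have the
same simple letters and the same block contents (`Holds.count_eq_one`, `Holds.mem_between`). They
can differ only by reversing first occurrences of some `w` and `z` within a block. Substituting 1
for most letters extracts from such a reversal one law valid in `V`: σ_∞ if `w` and `z` share an
earlier block, otherwise σ_n, where n counts the runs in which they alternate beforehand; `L₂¹`
excludes n = 0. The same law suffices to perform the swap (`Holds.swap`). So every identity of `V`
follows from letter repetition and the laws σ valid in `V` (`Holds.transfer`), and Birkhoff's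
theorem makes these laws define `V` inside the variety of `E¹`. As σ_n implies σ_{n+1} and σ_∞
there, only the listed varieties remain.

For strictness, σ_∞ fails in `E¹` itself. To separate σ_n from σ_{n+1}, take the syntactic monoid of
the set of words that equal the left side `G` of σ_n in `E¹`. Such words are read by an automaton
whose first n blocks each allow only one of x, y (`exists_blockRun_of_evalWord_eq`). Therefore n + 1
alternating squares force entry into the last block, where the final swap is invisible to `E¹`. -/

/-! ### Evaluation of words and Birkhoff's theorem. -/

/-- The value of a word under a substitution. -/
def evalWord {M : Type*} [Monoid M] (θ : ℕ → M) (l : List ℕ) : M := (l.map θ).prod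

section evalWord

variable {M : Type*} [Monoid M] (θ : ℕ → M)

@[simp] theorem evalWord_nil : evalWord θ [] = 1 := rfl

@[simp] theorem evalWord_cons (c : ℕ) (l : List ℕ) :
    evalWord θ (c :: l) = θ c * evalWord θ l := by simp [evalWord]

@[simp] theorem evalWord_append (l₁ l₂ : List ℕ) :
    evalWord θ (l₁ ++ l₂) = evalWord θ l₁ * evalWord θ l₂ := by simp [evalWord]

theorem evalWord_eq_lift (w : Word) : FreeMonoid.lift θ w = evalWord θ w.toList :=
  FreeMonoid.lift_apply θ w

theorem evalWord_congr {θ θ' : ℕ → M} {l : List ℕ} (h : ∀ c ∈ l, θ c = θ' c) :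
    evalWord θ l = evalWord θ' l := by
  unfold evalWord
  rw [List.map_congr_left h]

theorem evalWord_eq_one {θ : ℕ → M} {l : List ℕ} (h : ∀ c ∈ l, θ c = 1) : evalWord θ l = 1 :=
  List.prod_eq_one (by simpa using h)

end evalWord

/-- The identity between two words given as lists of letters. -/
def listIdentity (u v : List ℕ) : WordIdentity := ⟨FreeMonoid.ofList u, FreeMonoid.ofList v⟩

theorem listIdentity_satisfiedBy {u v : List ℕ} {M : Type u} [Monoid M] :
    (listIdentity u v).SatisfiedBy M ↔ ∀ θ : ℕ → M, evalWord θ u = evalWord θ v := by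
  simp only [WordIdentity.SatisfiedBy, listIdentity, evalWord_eq_lift, FreeMonoid.toList_ofList]

namespace MonoidVariety

/-- `V.Holds u v` says that every member of `V` satisfies the identity `u ≈ v`. -/
def Holds (V : MonoidVariety.{u}) (u v : List ℕ) : Prop :=
  ∀ (M : Type u) [Monoid M], V.Mem M → ∀ θ : ℕ → M, evalWord θ u = evalWord θ v

/-- The variety of all monoids satisfying an identity. -/
def ofIdentity (p : WordIdentity) : MonoidVariety.{u} where
  Mem M _ := p.SatisfiedBy M
  image f hf h := h.image f hf
  submonoid S h := h.of_injective S.subtype Subtype.val_injective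
  pi M _ h := WordIdentity.SatisfiedBy.pi M h

theorem mem_generatedBy (M : Type u) [Monoid M] : (generatedBy M).Mem M := fun _ h => h

theorem generatedBy_le {M : Type u} [Monoid M] {V : MonoidVariety.{u}} (h : V.Mem M) :
    generatedBy M ≤ V := fun _ _ hN => hN V h

theorem satisfiedBy_of_mem_generatedBy {M N : Type u} [Monoid M] [Monoid N] {p : WordIdentity}
    (hN : (generatedBy M).Mem N) (h : p.SatisfiedBy M) : p.SatisfiedBy N :=
  hN (ofIdentity p) h

theorem mem_prod (V : MonoidVariety.{u}) {M N : Type u} [Monoid M] [Monoid N] (hM : V.Mem M)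
    (hN : V.Mem N) : V.Mem (M × N) := by
  let F : ULift.{u} Bool → Type u := fun b => if b.down then M else N
  let inst : ∀ b, Monoid (F b) := fun b => by
    rcases b with ⟨_ | _⟩
    · exact ‹Monoid N›
    · exact ‹Monoid M›
  have h : V.Mem (∀ b, F b) := V.pi F fun b => by
    rcases b with ⟨_ | _⟩
    · exact hN
    · exact hM
  let f : (∀ b, F b) →* M × N :=
    { toFun := fun p => (p ⟨true⟩, p ⟨false⟩)
      map_one' := rfl
      map_mul' := fun _ _ => rfl }
  refine V.image f (fun p => ⟨fun b => ?_, ?_⟩) h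
  · rcases b with ⟨_ | _⟩
    · exact p.2
    · exact p.1
  · rfl

theorem mem_of_injective (V : MonoidVariety.{u}) {M N : Type u} [Monoid M] [Monoid N]
    (f : M →* N) (hf : Function.Injective f) (hN : V.Mem N) : V.Mem M := by
  let e : M ≃* MonoidHom.mrange f := MulEquiv.ofBijective f.mrangeRestrict
    ⟨fun _ _ h => hf (congrArg Subtype.val h), f.mrangeRestrict_surjective⟩
  exact V.image e.symm.toMonoidHom e.symm.surjective (V.submonoid (MonoidHom.mrange f) hN)

open Classical in
/-- **Birkhoff's theorem**: a monoid satisfying all identities of a variety belongs to it. -/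
theorem mem_of_identities (V : MonoidVariety.{u}) (M : Type u) [Monoid M]
    (hM : ∀ u v, V.Holds u v → ∀ θ : ℕ → M, evalWord θ u = evalWord θ v) : V.Mem M := by
  -- One separating member of `V` is kept per separable pair, so the product is indexed by a type in
  -- the right universe and still separates all these pairs.
  let Bad := {q : FreeMonoid M × FreeMonoid M //
    ∃ (N : Type u) (_ : Monoid N), V.Mem N ∧
      ∃ θ : M → N, FreeMonoid.lift θ q.1 ≠ FreeMonoid.lift θ q.2}
  choose N inst hN θ hθ using fun q : Bad => q.2
  let η : FreeMonoid M →* ∀ q, N q := FreeMonoid.lift fun m q => θ q m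
  have hη : ∀ w q, η w q = FreeMonoid.lift (θ q) w := by
    intro w q
    have : (Pi.evalMonoidHom N q).comp η = FreeMonoid.lift (θ q) := by
      ext m
      simp [η]
    rw [← this]
    rfl
  let π : FreeMonoid M →* M := FreeMonoid.lift id
  have key : ∀ w w', η w = η w' → π w = π w' := by
    intro w w' h
    have hV : ∀ (K : Type u) [Monoid K], V.Mem K → ∀ τ : M → K,
        FreeMonoid.lift τ w = FreeMonoid.lift τ w' := by
      intro K _ hK τ
      by_contra hne
      let q : Bad := ⟨(w, w'), K, inferInstance, hK, τ, hne⟩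
      apply hθ q
      rw [← hη, ← hη]
      exact congrFun h q
    -- Letters are renumbered by their position in `L` to obtain an identity over ℕ; the default
    -- value 1 is never reached on them.
    let L := w.toList ++ w'.toList
    have hL : ∀ m ∈ L, (fun i => L.getD i 1) (L.idxOf m) = m := by
      intro m hm
      simp [List.getElem?_idxOf hm]
    have := hM (w.toList.map L.idxOf) (w'.toList.map L.idxOf) (by
      intro K _ hK τ
      simpa [evalWord, FreeMonoid.lift_apply, Function.comp_def] using hV K hK (τ ∘ L.idxOf))
      (fun i => L.getD i 1)
    have hL' : ∀ l : List M, (∀ m ∈ l, m ∈ L) →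
        evalWord (fun i => L.getD i 1) (l.map L.idxOf) = l.prod := by
      intro l hl
      rw [evalWord, List.map_map, List.map_congr_left (g := id), List.map_id]
      exact fun m hm => hL m (hl m hm)
    rw [hL' _ fun m hm => by simp [L, hm], hL' _ fun m hm => by simp [L, hm]] at this
    simpa [π, FreeMonoid.lift_apply] using this
  have hmem : V.Mem (MonoidHom.mrange η) := V.submonoid _ (V.pi N hN)
  choose g hg using fun p : MonoidHom.mrange η => p.2
  let f : MonoidHom.mrange η →* M :=
    { toFun := fun p => π (g p)
      map_one' := by
        rw [← map_one π]
        exact key _ _ (by rw [hg, map_one]; rfl)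
      map_mul' := fun p q => by
        rw [← map_mul]
        exact key _ _ (by rw [hg, map_mul, hg, hg]; rfl) }
  refine V.image f (fun m => ⟨⟨η (FreeMonoid.of m), _, rfl⟩, ?_⟩) hmem
  have : π (FreeMonoid.of m) = m := by simp [π]
  rw [← this]
  exact key _ _ (hg _)

end MonoidVariety

/-! ### Letter repetition in `E¹`; `L₂¹` and `Q¹` lie in its variety. -/

/-- `N` allows a letter of a factor `B` to be repeated at the end of `B`, as long as all
letters of `B` occur at least twice in the whole word. -/
def RepeatsLetters (N : Type*) [Monoid N] : Prop :=
  ∀ (A B C : List ℕ) (w : ℕ) (θ : ℕ → N), w ∈ B → (∀ c ∈ B, 2 ≤ (A ++ (B ++ C)).count c) →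
    evalWord θ (A ++ (B ++ C)) = evalWord θ (A ++ (B ++ w :: C))

namespace SemigroupE

/-- The ideal `{0, a, ac}` of `E¹`. -/
def InIdeal (p : WithOne SemigroupE.{u}) : Prop :=
  p = ((zero : SemigroupE) : WithOne SemigroupE) ∨ p = ((a : SemigroupE) : WithOne SemigroupE) ∨
    p = ((ac : SemigroupE) : WithOne SemigroupE)

theorem not_inIdeal {p : WithOne SemigroupE.{u}} (h : ¬ InIdeal p) :
    p = 1 ∨ p = ((b : SemigroupE) : WithOne SemigroupE) ∨
      p = ((c : SemigroupE) : WithOne SemigroupE) := by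
  rcases p with _ | ⟨_ | _ | _ | _ | _⟩
  · exact Or.inl rfl
  · exact absurd (Or.inl rfl) h
  · exact absurd (Or.inr (Or.inl rfl)) h
  · exact absurd (Or.inr (Or.inr rfl)) h
  · exact Or.inr (Or.inl rfl)
  · exact Or.inr (Or.inr rfl)

theorem InIdeal.mul_right {p : WithOne SemigroupE.{u}} (h : InIdeal p) (q : WithOne SemigroupE) :
    InIdeal (p * q) := by
  rcases h with rfl | rfl | rfl <;> rcases q with _ | ⟨_ | _ | _ | _ | _⟩ <;>
    first | exact Or.inl rfl | exact Or.inr (Or.inl rfl) | exact Or.inr (Or.inr rfl)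

theorem InIdeal.mul_left {p : WithOne SemigroupE.{u}} (h : InIdeal p) (q : WithOne SemigroupE) :
    InIdeal (q * p) := by
  rcases h with rfl | rfl | rfl <;> rcases q with _ | ⟨_ | _ | _ | _ | _⟩ <;>
    first | exact Or.inl rfl | exact Or.inr (Or.inl rfl) | exact Or.inr (Or.inr rfl)

theorem InIdeal.mul_eq_zero {p q : WithOne SemigroupE.{u}} (hp : InIdeal p) (hq : InIdeal q) :
    p * q = ((zero : SemigroupE) : WithOne SemigroupE) := by
  rcases hp with rfl | rfl | rfl <;> rcases hq with rfl | rfl | rfl <;> rfl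

theorem zero_mul' (p : WithOne SemigroupE.{u}) :
    ((zero : SemigroupE) : WithOne SemigroupE) * p = ((zero : SemigroupE) : WithOne SemigroupE) := by
  rcases p with _ | ⟨_ | _ | _ | _ | _⟩ <;> rfl

theorem mul_zero' (p : WithOne SemigroupE.{u}) :
    p * ((zero : SemigroupE) : WithOne SemigroupE) = ((zero : SemigroupE) : WithOne SemigroupE) := by
  rcases p with _ | ⟨_ | _ | _ | _ | _⟩ <;> rfl

theorem not_inIdeal_mul {p q : WithOne SemigroupE.{u}} (hp : ¬ InIdeal p) (hq : ¬ InIdeal q) :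
    ¬ InIdeal (p * q) := by
  rcases not_inIdeal hp with rfl | rfl | rfl <;> rcases not_inIdeal hq with rfl | rfl | rfl <;>
    rintro (h | h | h) <;> cases h

theorem mul_mul_self {p q : WithOne SemigroupE.{u}} (hp : ¬ InIdeal p) (hq : ¬ InIdeal q) :
    p * q * p = p * q := by
  rcases not_inIdeal hp with rfl | rfl | rfl <;> rcases not_inIdeal hq with rfl | rfl | rfl <;> rfl

theorem not_inIdeal_evalWord {θ : ℕ → WithOne SemigroupE.{u}} {l : List ℕ}
    (h : ∀ c ∈ l, ¬ InIdeal (θ c)) : ¬ InIdeal (evalWord θ l) := by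
  induction l with
  | nil => rintro (h | h | h) <;> cases h
  | cons d l ih =>
    rw [evalWord_cons]
    exact not_inIdeal_mul (h d (by simp)) (ih fun c hc => h c (by simp [hc]))

theorem inIdeal_evalWord {θ : ℕ → WithOne SemigroupE.{u}} {l : List ℕ} {c : ℕ} (hc : c ∈ l)
    (h : InIdeal (θ c)) : InIdeal (evalWord θ l) := by
  obtain ⟨s, t, rfl⟩ := List.append_of_mem hc
  rw [evalWord_append, evalWord_cons]
  exact (h.mul_right _).mul_left _

theorem evalWord_eq_zero {θ : ℕ → WithOne SemigroupE.{u}} {l : List ℕ} {c : ℕ}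
    (h : InIdeal (θ c)) (hc : 2 ≤ l.count c) :
    evalWord θ l = ((zero : SemigroupE) : WithOne SemigroupE) := by
  have hm : c ∈ l := List.count_pos_iff.mp (by omega)
  obtain ⟨s, t, rfl⟩ := List.append_of_mem hm
  simp only [List.count_append, List.count_cons_self] at hc
  rw [evalWord_append, evalWord_cons]
  rcases Nat.eq_zero_or_pos (s.count c) with h0 | h0
  · have : c ∈ t := List.count_pos_iff.mp (by omega)
    rw [h.mul_eq_zero (inIdeal_evalWord this h), mul_zero']
  · rw [← mul_assoc, (inIdeal_evalWord (List.count_pos_iff.mp h0) h).mul_eq_zero h, zero_mul']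

/-- If all letters of the factor take values in `{1, b, c}`, the law `pqp = pq` absorbs the new
letter. Otherwise a letter with value in the square-zero ideal occurs twice and both sides vanish.
-/
theorem repeatsLetters : RepeatsLetters (WithOne SemigroupE.{u}) := by
  intro A B C w θ hw hB
  by_cases hI : ∀ c ∈ B, ¬ InIdeal (θ c)
  · obtain ⟨s, t, rfl⟩ := List.append_of_mem hw
    have h := mul_mul_self (hI w (by simp))
      (not_inIdeal_evalWord (l := t) fun c hc => hI c (by simp [hc]))
    calc _ = evalWord θ A * evalWord θ s * (θ w * evalWord θ t) * evalWord θ C := by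
          simp [mul_assoc]
      _ = evalWord θ A * evalWord θ s * (θ w * evalWord θ t * θ w) * evalWord θ C := by rw [h]
      _ = _ := by simp [mul_assoc]
  · push Not at hI
    obtain ⟨c, hc, hi⟩ := hI
    rw [evalWord_eq_zero hi (hB c hc), evalWord_eq_zero (c := c) hi]
    refine (hB c hc).trans ?_
    simp only [List.count_append, List.count_cons]
    omega

end SemigroupE

theorem repeatsLetters_of_mem_varietyE {M : Type u} [Monoid M] (h : varietyE.Mem M) :
    RepeatsLetters M := by
  intro A B C w θ hw hB
  refine listIdentity_satisfiedBy.mp (MonoidVariety.satisfiedBy_of_mem_generatedBy h ?_) θ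
  exact listIdentity_satisfiedBy.mpr fun θ => SemigroupE.repeatsLetters A B C w θ hw hB

theorem varietyL₂_le_varietyE : varietyL₂.{u} ≤ varietyE.{u} := by
  refine MonoidVariety.generatedBy_le ?_
  let f : SemigroupL₂.{u} →ₙ* SemigroupE.{u} :=
    { toFun := fun p => match p with
        | .a => .b
        | .b => .c
      map_mul' := by rintro (_ | _) (_ | _) <;> rfl }
  refine varietyE.mem_of_injective (WithOne.mapMulHom f) ?_ (MonoidVariety.mem_generatedBy _)
  rintro (_ | ⟨_ | _⟩) (_ | ⟨_ | _⟩) h <;> first | rfl | cases h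

namespace SemigroupQ

/-- The elements of `E¹ × E¹` lying over nonzero elements of `Q¹`. -/
def ofPair : WithOne SemigroupE.{u} × WithOne SemigroupE.{u} → WithOne SemigroupQ.{u}
  | (none, none) => none
  | (none, some .b) => some .a
  | (some .b, some .a) => some .b
  | (some .a, some .ac) => some .bc
  | (some .a, some .c) => some .c
  | _ => some .zero

/-- Membership in the submonoid of `E¹ × E¹` generated by `(1, b)`, `(b, a)` and `(a, c)`
together with `(1, 0)`. -/
inductive IsPair : WithOne SemigroupE.{u} → WithOne SemigroupE.{u} → Prop
  | one_one : IsPair none none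
  | one_b : IsPair none (some .b)
  | one_zero : IsPair none (some .zero)
  | b_a : IsPair (some .b) (some .a)
  | b_zero : IsPair (some .b) (some .zero)
  | a_ac : IsPair (some .a) (some .ac)
  | a_c : IsPair (some .a) (some .c)
  | a_b : IsPair (some .a) (some .b)
  | a_zero : IsPair (some .a) (some .zero)
  | zero_zero : IsPair (some .zero) (some .zero)
  | zero_a : IsPair (some .zero) (some .a)
  | zero_ac : IsPair (some .zero) (some .ac)
  | zero_b : IsPair (some .zero) (some .b)
  | zero_c : IsPair (some .zero) (some .c)

/-- A submonoid of `E¹ × E¹` of which `Q¹` is a homomorphic image. -/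
def pairs : Submonoid (WithOne SemigroupE.{u} × WithOne SemigroupE.{u}) where
  carrier := {p | IsPair p.1 p.2}
  one_mem' := IsPair.one_one
  mul_mem' := by
    rintro ⟨p, p'⟩ ⟨q, q'⟩ (hp : IsPair p p') (hq : IsPair q q')
    change IsPair (p * q) (p' * q')
    cases hp <;> cases hq <;> constructor

end SemigroupQ

open SemigroupQ in
theorem varietyQ_le_varietyE : varietyQ.{u} ≤ varietyE.{u} := by
  refine MonoidVariety.generatedBy_le ?_
  have hE := MonoidVariety.mem_generatedBy (WithOne SemigroupE.{u})
  -- `Q¹` divides `E¹ × E¹`: the pairs `(1, b)`, `(b, a)`, `(a, c)` go to `a`, `b`, `c`, and the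
  -- unlisted pairs collapse to 0.
  let f : SemigroupQ.pairs.{u} →* WithOne SemigroupQ.{u} :=
    { toFun := fun p => SemigroupQ.ofPair p.1
      map_one' := rfl
      map_mul' := by
        rintro ⟨⟨p, p'⟩, (hp : IsPair p p')⟩ ⟨⟨q, q'⟩, (hq : IsPair q q')⟩
        cases hp <;> cases hq <;> rfl }
  refine varietyE.image f ?_ (varietyE.submonoid SemigroupQ.pairs (varietyE.mem_prod hE hE))
  have hs : ∀ p p' (_ : IsPair.{u} p p'), ∃ q, f q = SemigroupQ.ofPair (p, p') :=
    fun p p' hp => ⟨⟨(p, p'), hp⟩, rfl⟩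
  rintro (_ | ⟨_ | _ | _ | _ | _⟩)
  · exact hs _ _ .one_one
  · exact hs _ _ .zero_zero
  · exact hs _ _ .one_b
  · exact hs _ _ .b_a
  · exact hs _ _ .a_c
  · exact hs _ _ .a_ac

/-! ### The identities σ_n and σ_∞ as laws on elements. -/

section altProd

variable {M : Type*} [Monoid M]

/-- The alternating product `x (h 0) y (h 1) x (h 2) ⋯` with `n` factors `x` or `y`. -/
def altProd : ℕ → M → M → (ℕ → M) → M
  | 0, _, _, _ => 1
  | n + 1, x, y, h => x * h 0 * altProd n y x fun i => h (i + 1)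

@[simp] theorem altProd_zero (x y : M) (h : ℕ → M) : altProd 0 x y h = 1 := rfl

theorem altProd_succ (n : ℕ) (x y : M) (h : ℕ → M) :
    altProd (n + 1) x y h = x * h 0 * altProd n y x fun i => h (i + 1) := rfl

variable (M)

/-- Squares commute after an alternating product of squares with `n` factors. -/
def SwapsAfterAlt (n : ℕ) : Prop :=
  ∀ (x y : M) (h : ℕ → M),
    altProd n (x ^ 2) (y ^ 2) h * (x ^ 2 * y ^ 2) = altProd n (x ^ 2) (y ^ 2) h * (y ^ 2 * x ^ 2)

/-- Squares commute after their product has occurred. -/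
def SwapsAfterBoth : Prop :=
  ∀ x y h : M, x ^ 2 * y ^ 2 * h * (x ^ 2 * y ^ 2) = x ^ 2 * y ^ 2 * h * (y ^ 2 * x ^ 2)

variable {M}

theorem lift_e_mul_h_prod (θ : ℕ → M) (n k : ℕ) :
    FreeMonoid.lift θ ((List.range' k n).map fun i => Word.e i * Word.h i).prod =
      if Odd k then altProd n (θ 0 ^ 2) (θ 1 ^ 2) fun j => θ (k + j + 1)
      else altProd n (θ 1 ^ 2) (θ 0 ^ 2) fun j => θ (k + j + 1) := by
  induction n generalizing k with
  | zero => simp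
  | succ n ih =>
    rw [List.range'_succ, List.map_cons, List.prod_cons, map_mul, ih (k + 1)]
    have h1 : (fun j => θ (k + 1 + j + 1)) = fun j => θ (k + (j + 1) + 1) := by
      funext j
      congr 1
      omega
    by_cases hk : Odd k
    · have hk' : ¬ Odd (k + 1) := by simpa [Nat.odd_add_one] using hk
      simp [hk, hk', Word.e, Word.h, Word.x, altProd_succ, h1]
    · have hk' : Odd (k + 1) := by simpa [Nat.odd_add_one] using hk
      simp [hk, hk', Word.e, Word.h, Word.y, altProd_succ, h1]

theorem sigma_satisfiedBy {M : Type u} [Monoid M] (n : ℕ) :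
    (sigma n).SatisfiedBy M ↔ SwapsAfterAlt M n := by
  have key : ∀ θ : ℕ → M, FreeMonoid.lift θ (Word.sigmaPrefix n) =
      altProd n (θ 0 ^ 2) (θ 1 ^ 2) fun j => θ (j + 2) := by
    intro θ
    rw [Word.sigmaPrefix, lift_e_mul_h_prod, if_pos odd_one]
    congr 1
    funext j
    congr 1
    omega
  constructor
  · intro H x y h
    have := H fun i => match i with
      | 0 => x
      | 1 => y
      | i + 2 => h i
    simpa [sigma, key, Word.x, Word.y] using this
  · intro H θ
    simpa [sigma, key, Word.x, Word.y] using H (θ 0) (θ 1) fun j => θ (j + 2)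

theorem sigmaInf_satisfiedBy {M : Type u} [Monoid M] :
    sigmaInf.SatisfiedBy M ↔ SwapsAfterBoth M := by
  constructor
  · intro H x y h
    have := H fun i => match i with
      | 0 => x
      | 1 => y
      | _ + 2 => h
    simpa [sigmaInf, Word.x, Word.y, Word.h] using this
  · intro H θ
    simpa [sigmaInf, Word.x, Word.y, Word.h] using H (θ 0) (θ 1) (θ 2)

theorem SwapsAfterAlt.succ {n : ℕ} (H : SwapsAfterAlt M n) : SwapsAfterAlt M (n + 1) := by
  intro x y h
  rw [altProd_succ, mul_assoc _ _ (x ^ 2 * y ^ 2), ← H y x]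
  simp only [mul_assoc]

theorem SwapsAfterAlt.mono {m n : ℕ} (h : m ≤ n) (H : SwapsAfterAlt M m) : SwapsAfterAlt M n := by
  induction h with
  | refl => exact H
  | step _ ih => exact ih.succ

end altProd

namespace RepeatsLetters

variable {N : Type*} [Monoid N]

theorem sq_mul_sq (H : RepeatsLetters N) (x : N) : x ^ 2 * x ^ 2 = x ^ 2 := by
  have h1 := H [] [0, 0] [] 0 (fun _ => x) (by simp) (by simp)
  have h2 := H [] [0, 0] [0] 0 (fun _ => x) (by simp) (by simp)
  simp only [List.nil_append, List.append_nil, List.cons_append, evalWord_cons, evalWord_nil,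
    mul_one] at h1 h2
  rw [sq, mul_assoc, ← h2, ← h1]

theorem sq_mul_sq_mul_sq (H : RepeatsLetters N) (x y : N) :
    x ^ 2 * y ^ 2 * x ^ 2 = x ^ 2 * y ^ 2 := by
  let θ : ℕ → N := fun i => if i = 0 then x else y
  have h1 := H [] [0, 0, 1, 1] [] 0 θ (by simp) (by simp)
  have h2 := H [] [0, 0, 1, 1] [0] 0 θ (by simp) (by simp)
  simp only [List.nil_append, List.append_nil, List.cons_append, evalWord_cons, evalWord_nil,
    mul_one, θ, if_true, one_ne_zero, if_false] at h1 h2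
  simp only [sq, mul_assoc] at *
  rw [← h2, ← h1]

theorem insert_list (H : RepeatsLetters N) (θ : ℕ → N) {A B u C : List ℕ} (hu : ∀ c ∈ u, c ∈ B)
    (hB : ∀ c ∈ B, 2 ≤ (A ++ (B ++ C)).count c) :
    evalWord θ (A ++ (B ++ C)) = evalWord θ (A ++ (B ++ (u ++ C))) := by
  induction u with
  | nil => rfl
  | cons d u ih =>
    rw [ih fun c hc => hu c (by simp [hc]),
      H A B (u ++ C) d θ (hu d (by simp)) fun c hc => (hB c hc).trans ?_]
    · rfl
    · simp only [List.count_append]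
      omega

theorem insert_adjacent (H : RepeatsLetters N) (θ : ℕ → N) {A C : List ℕ} {w : ℕ}
    (hw : 2 ≤ (A ++ w :: C).count w) :
    evalWord θ (A ++ w :: C) = evalWord θ (A ++ w :: w :: C) :=
  H A [w] C w θ (by simp) (by simpa using hw)

/-- By `x²y²x² = x²y²`, an alternating prefix whose free factors are trivial, except the last one
supplying a further square and `g`, collapses to `x²y²g`. Passing to n + 1 keeps the prefix
nonempty. -/
theorem swapsAfterBoth (H : RepeatsLetters N) {n : ℕ} (hn : SwapsAfterAlt N n) :
    SwapsAfterBoth N := by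
  have key : ∀ m, ∀ x y g : N, ∃ h, altProd (m + 1) (x ^ 2) (y ^ 2) h = x ^ 2 * y ^ 2 * g := by
    intro m
    induction m with
    | zero => exact fun x y g => ⟨fun _ => y ^ 2 * g, by simp [altProd_succ, mul_assoc]⟩
    | succ m ih =>
      intro x y g
      obtain ⟨h, hh⟩ := ih y x g
      refine ⟨fun i => match i with
        | 0 => 1
        | i + 1 => h i, ?_⟩
      rw [altProd_succ, hh, mul_one, ← mul_assoc, ← mul_assoc, H.sq_mul_sq_mul_sq]
  intro x y g
  obtain ⟨h, hh⟩ := key n x y g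
  rw [← hh, hn.succ]

end RepeatsLetters

/-! ### Words in which two letters alternate. -/

/-- `Alternates T n w z L` says that `w` and `z` occur alternately in `L`, starting with `w`, in
`n` runs, each of them followed by a letter from `T` before the next run starts. -/
inductive Alternates (T : ℕ → Prop) : ℕ → ℕ → ℕ → List ℕ → Prop
  | zero {w z : ℕ} {L : List ℕ} : w ∉ L → z ∉ L → Alternates T 0 w z L
  | succ {n w z t : ℕ} {A B L : List ℕ} : w ∉ A → z ∉ A → z ∉ B → T t → Alternates T n z w L →
      Alternates T (n + 1) w z (A ++ w :: (B ++ t :: L))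

namespace Alternates

variable {T : ℕ → Prop} {n w z : ℕ} {L : List ℕ}

theorem append (h : Alternates T n w z L) {B : List ℕ} (hw : w ∉ B) (hz : z ∉ B) :
    Alternates T n w z (L ++ B) := by
  induction h with
  | zero h1 h2 => exact .zero (by simp [h1, hw]) (by simp [h2, hz])
  | succ h1 h2 h3 h4 _ ih =>
    simp only [List.append_assoc, List.cons_append]
    exact .succ h1 h2 h3 h4 (ih hz hw)

/-- Each run collapses to the idempotent `x` or `y`. The `T`-letter chosen to close a run occurs
only once, so it can take the prescribed value `h i`; remaining letters go to 1. -/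
theorem realize {N : Type*} [Monoid N] (hL : Alternates T n w z L) {x y : N} (hx : x * x = x)
    (hy : y * y = y) (hwz : w ≠ z) (hw : ¬ T w) (hz : ¬ T z) (hT : ∀ t, T t → L.count t ≤ 1)
    (h : ℕ → N) :
    ∃ θ : ℕ → N, θ w = x ∧ θ z = y ∧ (∀ c, c ≠ w → c ≠ z → (c ∉ L ∨ ¬ T c) → θ c = 1) ∧
      evalWord θ L = altProd n x y h := by
  induction hL generalizing x y h with
  | @zero w z L h1 h2 =>
    refine ⟨fun c => if c = w then x else if c = z then y else 1, by simp, by simp [hwz.symm],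
      fun c h1 h2 _ => by simp [h1, h2], ?_⟩
    refine evalWord_eq_one fun c hc => ?_
    rw [if_neg (ne_of_mem_of_not_mem hc h1), if_neg (ne_of_mem_of_not_mem hc h2)]
  | @succ n w z t A B L h1 h2 h3 h4 _ ih =>
    have hcount : ∀ c, T c → A.count c + (B.count c + L.count c) +
        (if t = c then 1 else 0) + (if w = c then 1 else 0) ≤ 1 := by
      intro c hc
      have := hT c hc
      simp only [List.count_append, List.count_cons, beq_iff_eq] at this
      omega
    obtain ⟨θ, e1, e2, e3, e4⟩ := ih hy hx hwz.symm hz hw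
      (fun c hc => by have := hcount c hc; omega) fun i => h (i + 1)
    have htw : w ≠ t := fun e => hw (e ▸ h4)
    have htz : z ≠ t := fun e => hz (e ▸ h4)
    have htc := hcount t h4
    rw [if_pos rfl] at htc
    have hne : ∀ c, c ∈ A ∨ c ∈ B ∨ c ∈ L → c ≠ t := by
      rintro c hc rfl
      rcases hc with hc | hc | hc <;> have := List.count_pos_iff.mpr hc <;> omega
    have hone : ∀ c, c ∈ A ∨ c ∈ B → c ≠ w → c ≠ z → Function.update θ t (h 0) c = 1 := by
      intro c hc hcw hcz
      rw [Function.update_of_ne (hne c (by tauto))]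
      refine e3 c hcz hcw ?_
      by_contra! hcon
      have := hcount c hcon.2
      have := List.count_pos_iff.mpr hcon.1
      rcases hc with hc | hc <;> have := List.count_pos_iff.mpr hc <;> omega
    refine ⟨Function.update θ t (h 0), ?_, ?_, ?_, ?_⟩
    · rw [Function.update_of_ne htw, e2]
    · rw [Function.update_of_ne htz, e1]
    · intro c hcw hcz hc
      have hct : c ≠ t := by
        rintro rfl
        simp [h4] at hc
      rw [Function.update_of_ne hct]
      refine e3 c hcz hcw (hc.imp_left fun hc hcL => hc (by simp [hcL]))
    · have hB : ∀ l : List ℕ, (∀ c ∈ l, c ∈ B) →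
          x * evalWord (Function.update θ t (h 0)) l = x := by
        intro l
        induction l with
        | nil => simp
        | cons d l ih' =>
          intro hl
          have hd := hl d (by simp)
          have hl' := ih' fun c hc => hl c (by simp [hc])
          by_cases hdw : d = w
          · rw [evalWord_cons, hdw, Function.update_of_ne htw, e2, ← mul_assoc, hx, hl']
          · rw [evalWord_cons, hone d (Or.inr hd) hdw (ne_of_mem_of_not_mem hd h3), one_mul, hl']
      have hupd : evalWord (Function.update θ t (h 0)) L = evalWord θ L :=
        evalWord_congr fun c hc => Function.update_of_ne (hne c (Or.inr (Or.inr hc))) _ _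
      rw [evalWord_append, evalWord_cons, evalWord_append, evalWord_cons, ← mul_assoc (Function.update θ t (h 0) w),
        evalWord_eq_one fun c hc => hone c (Or.inl hc) (ne_of_mem_of_not_mem hc h1)
          (ne_of_mem_of_not_mem hc h2),
        Function.update_of_ne htw, e2, hB B (fun _ hc => hc), Function.update_self,
        hupd, e4,
        one_mul, altProd_succ, mul_assoc]

end Alternates

/-- Double every occurrence of the letters `w` and `z`. -/
def doubleLetters (w z : ℕ) (L : List ℕ) : List ℕ :=
  L.flatMap fun c => if c = w ∨ c = z then [c, c] else [c]

theorem doubleLetters_append (w z : ℕ) (L L' : List ℕ) :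
    doubleLetters w z (L ++ L') = doubleLetters w z L ++ doubleLetters w z L' := by
  simp [doubleLetters]

theorem doubleLetters_cons (w z c : ℕ) (L : List ℕ) :
    doubleLetters w z (c :: L) = (if c = w ∨ c = z then [c, c] else [c]) ++ doubleLetters w z L := by
  simp [doubleLetters]

theorem doubleLetters_comm (w z : ℕ) (L : List ℕ) :
    doubleLetters w z L = doubleLetters z w L := by
  simp [doubleLetters, or_comm]

/-- The occurrences in `R` already make `w` and `z` non-simple, so each occurrence in `L`, even a
lone one, can be doubled. -/
theorem RepeatsLetters.evalWord_doubleLetters {N : Type*} [Monoid N] (H : RepeatsLetters N)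
    (θ : ℕ → N) {w z : ℕ} (A L R : List ℕ) (hw : 2 ≤ R.count w) (hz : 2 ≤ R.count z) :
    evalWord θ (A ++ (L ++ R)) = evalWord θ (A ++ (doubleLetters w z L ++ R)) := by
  induction L generalizing A with
  | nil => rfl
  | cons d L ih =>
    rw [doubleLetters_cons]
    split_ifs with hd
    · have h2 : 2 ≤ R.count d := by rcases hd with rfl | rfl <;> assumption
      have h1 := H.insert_adjacent θ (A := A) (C := L ++ R) (w := d) (by
        simp only [List.count_append, List.count_cons]
        omega)
      have := ih (A ++ [d, d])
      simp only [List.append_assoc, List.cons_append, List.nil_append] at this ⊢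
      rw [h1, this]
    · have := ih (A ++ [d])
      simp only [List.append_assoc, List.cons_append, List.nil_append] at this ⊢
      exact this

/-- Doubling makes the first letter of each run a square; everything up to the next run is absorbed
by the free factors `h`. -/
theorem Alternates.evalWord_doubleLetters {T : ℕ → Prop} {n w z : ℕ} {L : List ℕ}
    (hL : Alternates T n w z L) {N : Type*} [Monoid N] (θ : ℕ → N) :
    ∃ g h, evalWord θ (doubleLetters w z L) = g * altProd n (θ w ^ 2) (θ z ^ 2) h := by
  induction hL with
  | zero => exact ⟨_, fun _ => 1, (mul_one _).symm⟩
  | @succ n w z t A B L _ _ _ _ _ ih =>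
    obtain ⟨g, h, hgh⟩ := ih
    refine ⟨evalWord θ (doubleLetters w z A), fun i => match i with
      | 0 => evalWord θ (doubleLetters w z (B ++ [t])) * g
      | i + 1 => h i, ?_⟩
    have : A ++ w :: (B ++ t :: L) = A ++ w :: ((B ++ [t]) ++ L) := by simp
    rw [this, doubleLetters_append, doubleLetters_cons, doubleLetters_append w z (B ++ [t]),
      altProd_succ, evalWord_append, evalWord_append, evalWord_append, doubleLetters_comm w z L, hgh]
    simp [sq, mul_assoc]

theorem RepeatsLetters.swap_of_alternates {N : Type*} [Monoid N] (H : RepeatsLetters N)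
    {T : ℕ → Prop} {n w z : ℕ} {L : List ℕ} (hn : SwapsAfterAlt N n) (hL : Alternates T n w z L)
    (θ : ℕ → N) (R : List ℕ) :
    evalWord θ (L ++ ([w, w, z, z] ++ R)) = evalWord θ (L ++ ([z, z, w, w] ++ R)) := by
  have h1 := H.evalWord_doubleLetters θ (w := w) (z := z) [] L ([w, w, z, z] ++ R)
    (by simp) (by by_cases h : w = z <;> simp [h])
  have h2 := H.evalWord_doubleLetters θ (w := w) (z := z) [] L ([z, z, w, w] ++ R)
    (by by_cases h : z = w <;> simp [h]) (by simp)
  rw [List.nil_append, List.nil_append] at h1 h2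
  obtain ⟨g, h, hgh⟩ := hL.evalWord_doubleLetters θ
  have h3 := hn (θ w) (θ z) h
  rw [h1, h2, evalWord_append, evalWord_append, evalWord_append, evalWord_append, hgh,
    ← mul_assoc, ← mul_assoc]
  congr 1
  rw [mul_assoc, mul_assoc]
  congr 1
  simpa [sq, mul_assoc] using h3

/-- Letters of `B` are repeatable, so `wwzz` can be inserted right after `B`; this supplies the
prefix that σ_∞ requires. -/
theorem RepeatsLetters.swap_of_mem_factor {N : Type*} [Monoid N] (H : RepeatsLetters N)
    {w z : ℕ} {A B C : List ℕ} (hn : SwapsAfterBoth N) (hw : w ∈ B) (hz : z ∈ B) (θ : ℕ → N)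
    (R : List ℕ) (hB : ∀ c ∈ B, 2 ≤ (A ++ (B ++ (C ++ ([w, w, z, z] ++ R)))).count c) :
    evalWord θ (A ++ (B ++ (C ++ ([w, w, z, z] ++ R)))) =
      evalWord θ (A ++ (B ++ (C ++ ([z, z, w, w] ++ R)))) := by
  have hu : ∀ c ∈ [w, w, z, z], c ∈ B := by simp [hw, hz]
  have hB' : ∀ c ∈ B, 2 ≤ (A ++ (B ++ (C ++ ([z, z, w, w] ++ R)))).count c := by
    intro c hc
    have := hB c hc
    simp only [List.count_append, List.count_cons, List.count_nil] at this ⊢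
    omega
  rw [H.insert_list θ hu hB, H.insert_list θ hu hB']
  have h3 := congrArg (· * evalWord θ R) (hn (θ w) (θ z) (evalWord θ C))
  simp only [evalWord_append, evalWord_cons, evalWord_nil]
  congr 2
  simpa [sq, mul_assoc] using h3

theorem List.exists_first_or_forall_not {α : Type*} (p : α → Prop) (l : List α) :
    (∀ c ∈ l, ¬ p c) ∨ ∃ A c B, l = A ++ c :: B ∧ p c ∧ ∀ d ∈ A, ¬ p d := by
  induction l with
  | nil => simp
  | cons d l ih =>
    by_cases hd : p d
    · exact Or.inr ⟨[], d, l, rfl, hd, by simp⟩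
    · rcases ih with ih | ⟨A, c, B, rfl, hc, hA⟩
      · exact Or.inl (by simpa [hd] using ih)
      · exact Or.inr ⟨d :: A, c, B, rfl, hc, by simpa [hd] using hA⟩

theorem List.exists_last_or_forall_not {α : Type*} (p : α → Prop) (l : List α) :
    (∀ c ∈ l, ¬ p c) ∨ ∃ A c B, l = A ++ c :: B ∧ p c ∧ ∀ d ∈ B, ¬ p d := by
  induction l with
  | nil => simp
  | cons d l ih =>
    rcases ih with ih | ⟨A, c, B, rfl, hc, hB⟩
    · by_cases hd : p d
      · exact Or.inr ⟨[], d, l, rfl, hd, ih⟩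
      · exact Or.inl (by simpa [hd] using ih)
    · exact Or.inr ⟨d :: A, c, B, rfl, hc, hB⟩

theorem List.exists_first_mem {c : ℕ} {l : List ℕ} (h : c ∈ l) :
    ∃ A B, l = A ++ c :: B ∧ c ∉ A := by
  rcases List.exists_first_or_forall_not (· = c) l with h' | ⟨A, d, B, rfl, rfl, hA⟩
  · exact absurd rfl (h' c h)
  · exact ⟨A, B, rfl, fun h => hA _ h rfl⟩

namespace Alternates

variable {T : ℕ → Prop} {s : ℕ}

/-- Between the first `w` and the first `z` there must be a `T`-letter, and after the last such
letter no `w` precedes `z`; so `z` opens the next run. The appended `s` closes the last run. -/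
theorem exists_of_first (hs : T s) (m : ℕ) : ∀ (w z : ℕ) (A L : List ℕ), L.length ≤ m →
    ¬ T w → ¬ T z → w ∉ A → z ∉ A →
    (∀ A' B C, A ++ w :: L = A' ++ (B ++ C) → (∀ c ∈ B, ¬ T c) → w ∈ B → z ∈ B → False) →
    ∃ n, Alternates T n w z (A ++ w :: (L ++ [s])) := by
  induction m with
  | zero =>
    intro w z A L hL _ _ hwA hzA h
    obtain rfl : L = [] := List.eq_nil_of_length_eq_zero (by omega)
    exact ⟨1, .succ (B := []) hwA hzA (by simp) hs (.zero (by simp) (by simp))⟩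
  | succ m ih =>
    intro w z A L hL hTw hTz hwA hzA h
    by_cases hz : z ∈ L
    · obtain ⟨D, P, rfl, hzD⟩ := List.exists_first_mem hz
      rcases List.exists_last_or_forall_not T D with hD | ⟨B, t, C, rfl, ht, hC⟩
      · refine (h A (w :: (D ++ [z])) P (by simp) ?_ (by simp) (by simp)).elim
        intro c hc
        simp only [List.mem_cons, List.mem_append, List.not_mem_nil, or_false] at hc
        rcases hc with rfl | hc | rfl
        · exact hTw
        · exact hD _ hc
        · exact hTz
      · simp only [List.mem_append, List.mem_cons, not_or] at hzD
        simp only [List.length_append, List.length_cons] at hL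
        have hwC : w ∉ C := by
          intro hw
          refine h (A ++ w :: (B ++ [t])) (C ++ [z]) P (by simp) ?_ (by simp [hw]) (by simp)
          intro c hc
          simp only [List.mem_append, List.mem_cons, List.not_mem_nil, or_false] at hc
          rcases hc with hc | rfl
          · exact hC _ hc
          · exact hTz
        obtain ⟨n, hn⟩ := ih z w C P (by omega) hTz hTw hzD.2.2 hwC fun A' B' C' e h1 h2 h3 =>
          h (A ++ w :: (B ++ t :: A')) B' C' (by simp [e]) h1 h3 h2
        refine ⟨n + 1, ?_⟩
        have := Alternates.succ hwA hzA hzD.1 ht hn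
        simpa using this
    · exact ⟨1, .succ hwA hzA hz hs (.zero (by simp) (by simp))⟩

theorem exists_or_exists (hs : T s) {w z : ℕ} (hw : ¬ T w) (hz : ¬ T z) {L : List ℕ}
    (h : ∀ A B C, L = A ++ (B ++ C) → (∀ c ∈ B, ¬ T c) → w ∈ B → z ∈ B → False) :
    ∃ n, Alternates T n w z (L ++ [s]) ∨ Alternates T n z w (L ++ [s]) := by
  rcases List.exists_first_or_forall_not (fun c => c = w ∨ c = z) L with
    hL | ⟨A, c, B, rfl, hc, hA⟩
  · refine ⟨0, Or.inl (.zero ?_ ?_)⟩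
    · have : w ≠ s := fun e => hw (e ▸ hs)
      simpa [this] using fun hw' => hL w hw' (Or.inl rfl)
    · have : z ≠ s := fun e => hz (e ▸ hs)
      simpa [this] using fun hz' => hL z hz' (Or.inr rfl)
  · have hwA : w ∉ A := fun h => hA w h (Or.inl rfl)
    have hzA : z ∉ A := fun h => hA z h (Or.inr rfl)
    rcases hc with rfl | rfl
    · obtain ⟨n, hn⟩ := exists_of_first hs B.length c z A B le_rfl hw hz hwA hzA h
      exact ⟨n, Or.inl (by simpa using hn)⟩
    · obtain ⟨n, hn⟩ := exists_of_first hs B.length c w A B le_rfl hz hw hzA hwA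
        fun A' B' C' e h1 h2 h3 => h A' B' C' e h1 h3 h2
      exact ⟨n, Or.inr (by simpa using hn)⟩

end Alternates

/-! ### What `Q¹` detects: simple letters and contents of blocks. -/

namespace SemigroupQ

theorem zero_mul' (p : WithOne SemigroupQ.{u}) :
    ((zero : SemigroupQ) : WithOne SemigroupQ) * p = ((zero : SemigroupQ) : WithOne SemigroupQ) := by
  rcases p with _ | ⟨_ | _ | _ | _ | _⟩ <;> rfl

theorem mul_zero' (p : WithOne SemigroupQ.{u}) :
    p * ((zero : SemigroupQ) : WithOne SemigroupQ) = ((zero : SemigroupQ) : WithOne SemigroupQ) := by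
  rcases p with _ | ⟨_ | _ | _ | _ | _⟩ <;> rfl

theorem evalWord_eq_one_or_a {θ : ℕ → WithOne SemigroupQ.{u}} {l : List ℕ}
    (h : ∀ c ∈ l, θ c = 1 ∨ θ c = ((a : SemigroupQ) : WithOne SemigroupQ)) :
    evalWord θ l = 1 ∨ evalWord θ l = ((a : SemigroupQ) : WithOne SemigroupQ) := by
  induction l with
  | nil => exact Or.inl rfl
  | cons d l ih =>
    rw [evalWord_cons]
    rcases h d (by simp) with h1 | h1 <;> rcases ih fun c hc => h c (by simp [hc]) with h2 | h2 <;>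
      rw [h1, h2]
    exacts [Or.inl rfl, Or.inr rfl, Or.inr rfl, Or.inr rfl]

theorem evalWord_eq_a {θ : ℕ → WithOne SemigroupQ.{u}} {l : List ℕ}
    (h : ∀ c ∈ l, θ c = 1 ∨ θ c = ((a : SemigroupQ) : WithOne SemigroupQ)) {x : ℕ} (hx : x ∈ l)
    (hxa : θ x = ((a : SemigroupQ) : WithOne SemigroupQ)) :
    evalWord θ l = ((a : SemigroupQ) : WithOne SemigroupQ) := by
  obtain ⟨s, t, rfl⟩ := List.append_of_mem hx
  rw [evalWord_append, evalWord_cons, hxa]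
  rcases evalWord_eq_one_or_a (l := s) fun c hc => h c (by simp [hc]) with h1 | h1 <;>
    rcases evalWord_eq_one_or_a (l := t) fun c hc => h c (by simp [hc]) with h2 | h2 <;>
    rw [h1, h2] <;> rfl

theorem evalWord_indicator (c : ℕ) (l : List ℕ) :
    evalWord (fun i => if i = c then ((b : SemigroupQ.{u}) : WithOne SemigroupQ.{u}) else 1) l =
      if l.count c = 0 then 1 else if l.count c = 1 then ((b : SemigroupQ) : WithOne SemigroupQ)
      else ((zero : SemigroupQ) : WithOne SemigroupQ) := by
  induction l with
  | nil => rfl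
  | cons d l ih =>
    rw [evalWord_cons, ih, List.count_cons]
    by_cases h : d = c
    · subst h
      rcases h0 : l.count d with _ | _ | n <;> simp <;> rfl
    · simp [h]

end SemigroupQ

namespace MonoidVariety

variable {V : MonoidVariety.{u}}

theorem Holds.symm {U U' : List ℕ} (h : V.Holds U U') : V.Holds U' U :=
  fun M _ hM θ => (h M hM θ).symm

theorem Holds.trans {U U' U'' : List ℕ} (h : V.Holds U U') (h' : V.Holds U' U'') :
    V.Holds U U'' :=
  fun M _ hM θ => (h M hM θ).trans (h' M hM θ)

/-- Since `b² = 0`, the value of a single letter `c ↦ b` tells apart zero, one and several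
occurrences. -/
theorem Holds.count_eq_one (hQ : V.Mem (WithOne SemigroupQ.{u})) {U U' : List ℕ}
    (h : V.Holds U U') {c : ℕ} (hc : U'.count c = 1) : U.count c = 1 := by
  have := h _ hQ fun i => if i = c then ((.b : SemigroupQ.{u}) : WithOne SemigroupQ.{u}) else 1
  rw [SemigroupQ.evalWord_indicator, SemigroupQ.evalWord_indicator, hc] at this
  by_contra hne
  rw [if_neg hne] at this
  split_ifs at this <;> first | omega | cases this

-- Put `s ↦ b`, `t ↦ c`, `x ↦ a`. By `ab = b` and `ca = c` an `x` outside the two markers is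
-- harmless, while `ba = 0` kills any word with an `x` between them.
open SemigroupQ in
theorem Holds.mem_between (hQ : V.Mem (WithOne SemigroupQ.{u})) {A B C A' B' C' : List ℕ}
    {s t x : ℕ} (h : V.Holds (A ++ s :: (B ++ t :: C)) (A' ++ s :: (B' ++ t :: C')))
    (hs : (A' ++ s :: (B' ++ t :: C')).count s = 1) (ht : (A' ++ s :: (B' ++ t :: C')).count t = 1)
    (hx : x ∈ B') : x ∈ B := by
  have hs' := h.count_eq_one hQ hs
  have ht' := h.count_eq_one hQ ht
  by_contra hxB
  have hst : t ≠ s := by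
    rintro rfl
    simp at hs
    omega
  simp only [List.count_append, List.count_cons, beq_iff_eq, ↓reduceIte, if_neg hst,
    if_neg hst.symm] at hs ht hs' ht'
  have hnot : ∀ {c : ℕ} {l : List ℕ}, l.count c = 0 → ∀ d ∈ l, d ≠ c := by
    rintro c l hc d hd rfl
    exact List.count_eq_zero.mp hc hd
  have hxs : x ≠ s := hnot (by omega) x hx
  have hxt : x ≠ t := hnot (by omega) x hx
  let θ : ℕ → WithOne SemigroupQ.{u} := fun i =>
    if i = s then ((b : SemigroupQ) : WithOne SemigroupQ)
    else if i = t then ((c : SemigroupQ) : WithOne SemigroupQ)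
    else if i = x then ((a : SemigroupQ) : WithOne SemigroupQ) else 1
  have hθs : θ s = ((b : SemigroupQ) : WithOne SemigroupQ) := if_pos rfl
  have hθt : θ t = ((c : SemigroupQ) : WithOne SemigroupQ) := by simp [θ, hst]
  have hθx : θ x = ((a : SemigroupQ) : WithOne SemigroupQ) := by simp [θ, hxs, hxt]
  have hθ : ∀ l : List ℕ, l.count s = 0 → l.count t = 0 → ∀ i ∈ l,
      θ i = 1 ∨ θ i = ((a : SemigroupQ) : WithOne SemigroupQ) := by
    intro l h1 h2 i hi
    have h1 := hnot h1 i hi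
    have h2 := hnot h2 i hi
    simp only [θ, if_neg h1, if_neg h2]
    split_ifs
    · exact Or.inr rfl
    · exact Or.inl rfl
  have hB : evalWord θ B = 1 := evalWord_eq_one fun i hi => by
    have h1 := hnot (by omega : B.count s = 0) i hi
    have h2 := hnot (by omega : B.count t = 0) i hi
    have h3 : i ≠ x := fun e => hxB (e ▸ hi)
    simp [θ, h1, h2, h3]
  have key := h _ hQ θ
  simp only [evalWord_append, evalWord_cons, hθs, hθt, hB] at key
  rw [evalWord_eq_a (hθ B' (by omega) (by omega)) hx hθx] at key
  have e1 : ∀ p : WithOne SemigroupQ.{u}, ((b : SemigroupQ) : WithOne SemigroupQ) *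
      (((a : SemigroupQ) : WithOne SemigroupQ) * p) = ((zero : SemigroupQ) : WithOne SemigroupQ) := by
    intro p
    rw [← mul_assoc]
    exact zero_mul' p
  rw [e1, mul_zero'] at key
  rcases evalWord_eq_one_or_a (hθ A (by omega) (by omega)) with h1 | h1 <;>
    rcases evalWord_eq_one_or_a (hθ C (by omega) (by omega)) with h2 | h2 <;>
    rw [h1, h2] at key <;> cases key

end MonoidVariety

/-! ### Order of first occurrences, and the laws a reversal forces. -/

/-- The letter `z` occurs in `l`, and so does `w` before the first occurrence of `z`. -/
def OccursBefore (w z : ℕ) (l : List ℕ) : Prop :=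
  ∃ A C, l = A ++ w :: C ∧ z ∉ A ∧ z ∈ C

theorem occursBefore_or {w z : ℕ} {l : List ℕ} (hwz : w ≠ z) (hw : w ∈ l) (hz : z ∈ l) :
    OccursBefore w z l ∨ OccursBefore z w l := by
  obtain ⟨A, C, rfl, hA⟩ := List.exists_first_mem hw
  by_cases hzA : z ∈ A
  · obtain ⟨A', C', rfl, hzA'⟩ := List.exists_first_mem hzA
    refine Or.inr ⟨A', C' ++ w :: C, by simp, ?_, by simp⟩
    exact fun h => hA (by simp [h])
  · refine Or.inl ⟨A, C, rfl, hzA, ?_⟩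
    simpa [hzA, hwz.symm] using hz

/-- Under these relations a product of copies of `θ w` and `θ z` remembers only which of them came
first. -/
theorem OccursBefore.evalWord_eq {N : Type*} [Monoid N] {w z : ℕ} {l : List ℕ}
    (h : OccursBefore w z l) {θ : ℕ → N} (hθ : ∀ c ∈ l, c ≠ w → c ≠ z → θ c = 1)
    (hw : θ w * θ w = θ w) (hz : θ z * θ z = θ z) (hwz : θ w * θ z * θ w = θ w * θ z) :
    evalWord θ l = θ w * θ z := by
  obtain ⟨A, C, rfl, hA, hC⟩ := h
  obtain ⟨C', D, rfl, hC'⟩ := List.exists_first_mem hC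
  have h1 : ∀ l : List ℕ, (∀ c ∈ l, c ≠ z ∧ (c ≠ w → θ c = 1)) →
      evalWord θ l * θ w = θ w ∧ θ w * evalWord θ l = θ w := by
    intro l
    induction l with
    | nil => simp
    | cons d l ih =>
      intro hl
      obtain ⟨e1, e2⟩ := ih fun c hc => hl c (by simp [hc])
      rw [evalWord_cons]
      by_cases hd : d = w
      · subst hd
        rw [mul_assoc, e1, ← mul_assoc, hw, e2]
        exact ⟨rfl, rfl⟩
      · rw [(hl d (by simp)).2 hd, one_mul]
        exact ⟨e1, e2⟩
  have h2 : ∀ l : List ℕ, (∀ c ∈ l, c ≠ w → c ≠ z → θ c = 1) →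
      θ w * θ z * evalWord θ l = θ w * θ z := by
    intro l
    induction l with
    | nil => simp
    | cons d l ih =>
      intro hl
      have ih := ih fun c hc => hl c (by simp [hc])
      rw [evalWord_cons, ← mul_assoc]
      by_cases hd : d = w
      · rw [hd, hwz, ih]
      · by_cases hd' : d = z
        · rw [hd', mul_assoc (θ w), hz, ih]
        · rw [hl d (by simp) hd hd', mul_one, ih]
  have hA' := (h1 A fun c hc => ⟨ne_of_mem_of_not_mem hc hA, fun hcw =>
    hθ c (by simp [hc]) hcw (ne_of_mem_of_not_mem hc hA)⟩).1
  have hC'' := (h1 C' fun c hc => ⟨ne_of_mem_of_not_mem hc hC', fun hcw =>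
    hθ c (by simp [hc]) hcw (ne_of_mem_of_not_mem hc hC')⟩).2
  simp only [evalWord_append, evalWord_cons]
  rw [← mul_assoc (θ w), hC'', ← mul_assoc (θ w), h2 D fun c hc => hθ c (by simp [hc]),
    ← mul_assoc, hA']

/-- The pair `zz` passes the letters of `u` from right to left. A letter already in `B` is redundant
and can be reinserted after `zz`; a new one is doubled so that the swap hypothesis applies. -/
theorem RepeatsLetters.move_left {N : Type*} [Monoid N] (H : RepeatsLetters N) (θ : ℕ → N)
    {T : ℕ → Prop} {L R : List ℕ} {z : ℕ} (hTz : ¬ T z) (u : List ℕ) :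
    ∀ B : List ℕ, (∀ c ∈ B, ¬ T c) → (∀ c ∈ u, ¬ T c) → z ∉ B → z ∉ u →
    (∀ c, (L ++ (B ++ (u ++ ([z, z] ++ R)))).count c = 1 → T c) →
    (∀ w ∈ u, w ∉ B → ∀ B' R' : List ℕ, (∀ c ∈ B', ¬ T c) → w ∉ B' → z ∉ B' →
      (∀ c, (L ++ (B' ++ ([w, w, z, z] ++ R'))).count c = 1 → T c) →
      evalWord θ (L ++ (B' ++ ([w, w, z, z] ++ R'))) =
        evalWord θ (L ++ (B' ++ ([z, z, w, w] ++ R')))) →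
    evalWord θ (L ++ (B ++ (u ++ ([z, z] ++ R)))) =
      evalWord θ (L ++ (B ++ ([z, z] ++ (u ++ R)))) := by
  induction u with
  | nil => intros; rfl
  | cons w u ih =>
    intro B hB hu hzB hzu hcount hswap
    simp only [List.mem_cons, not_or] at hzu
    have hTw : ¬ T w := hu w (by simp)
    have hge : ∀ c, ¬ T c → c ∈ L ++ (B ++ (w :: u ++ ([z, z] ++ R))) →
        2 ≤ (L ++ (B ++ (w :: u ++ ([z, z] ++ R)))).count c := by
      intro c hc hm
      have h1 := List.count_pos_iff.mpr hm
      have h2 : _ ≠ 1 := fun e => hc (hcount c e)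
      omega
    by_cases hwB : w ∈ B
    · have e1 := ih (B ++ [w]) (by simpa [or_imp, forall_and] using ⟨hB, hTw⟩)
        (fun c hc => hu c (by simp [hc])) (by simpa [hzB] using hzu.1) hzu.2
        (fun c hc => hcount c (by simpa using hc))
        (fun w' hw' hwB' => hswap w' (by simp [hw'])
          fun hw'' => hwB' (by simp [hw'']))
      have e2 := H L (B ++ [w, z, z]) (u ++ R) w θ (by simp) (by
        intro c hc
        have h1 : ¬ T c := by
          simp only [List.mem_append, List.mem_cons, List.not_mem_nil, or_false] at hc
          rcases hc with hc | rfl | rfl | rfl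
          exacts [hB c hc, hTw, hTz, hTz]
        refine (hge c h1 ?_).trans ?_
        · simp only [List.mem_append, List.mem_cons, List.not_mem_nil, or_false] at hc ⊢
          tauto
        · simp only [List.count_append, List.count_cons]
          omega)
      have e3 := H L B ([z, z] ++ (w :: u ++ R)) w θ hwB (by
        intro c hc
        refine (hge c (hB c hc) (by simp [hc])).trans ?_
        simp only [List.count_append, List.count_cons]
        omega)
      simp only [List.append_assoc, List.cons_append, List.nil_append] at e1 e2 e3 ⊢
      rw [e1, e2, e3]
    · have hz2 := hge z hTz (by simp)
      have e1 := ih (B ++ [w, w]) (by simpa [or_imp, forall_and] using ⟨hB, hTw⟩)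
        (fun c hc => hu c (by simp [hc])) (by simpa [hzB] using hzu.1) hzu.2
        (fun c hc => by
          by_contra hTc
          by_cases hm : c ∈ L ++ (B ++ (w :: u ++ ([z, z] ++ R)))
          · have := hge c hTc hm
            simp only [List.count_append, List.count_cons] at this hc
            omega
          · have := List.count_pos_iff.mp (Nat.lt_of_lt_of_eq Nat.one_pos hc.symm)
            simp only [List.mem_append, List.mem_cons, List.not_mem_nil, or_false] at this hm
            tauto)
        (fun w' hw' hwB' => hswap w' (by simp [hw'])
          fun hw'' => hwB' (by simp [hw'']))
      have e2 := hswap w (by simp) hwB B (u ++ R) hB hwB hzB (by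
        intro c hc
        by_contra hTc
        by_cases hm : c ∈ L ++ (B ++ (w :: u ++ ([z, z] ++ R)))
        · have := hge c hTc hm
          simp only [List.count_append, List.count_cons] at this hc
          omega
        · have := List.count_pos_iff.mp (Nat.lt_of_lt_of_eq Nat.one_pos hc.symm)
          simp only [List.mem_append, List.mem_cons, List.not_mem_nil, or_false] at this hm
          tauto)
      have hw2 := hge w hTw (by simp)
      have e3 := H.insert_adjacent θ (A := L ++ B) (C := u ++ ([z, z] ++ R)) (w := w)
        (by simpa using hw2)
      have e4 := H.insert_adjacent θ (A := L ++ (B ++ [z, z])) (C := u ++ R) (w := w) (by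
        simp only [List.count_append, List.count_cons, List.count_nil] at hw2 ⊢
        omega)
      simp only [List.append_assoc, List.cons_append, List.nil_append] at e1 e2 e3 e4 ⊢
      rw [e3, e1, e2, e4]

namespace MonoidVariety

/-- `N` satisfies all the swapping laws that hold throughout `V`. -/
structure SwapsPassTo (V : MonoidVariety.{u}) (N : Type u) [Monoid N] : Prop where
  alt : ∀ n, 1 ≤ n → (∀ (K : Type u) [Monoid K], V.Mem K → SwapsAfterAlt K n) → SwapsAfterAlt N n
  both : (∀ (K : Type u) [Monoid K], V.Mem K → SwapsAfterBoth K) → SwapsAfterBoth N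

theorem swapsPassTo_of_mem {V : MonoidVariety.{u}} {N : Type u} [Monoid N] (hN : V.Mem N) :
    V.SwapsPassTo N :=
  ⟨fun _ _ h => h N hN, fun h => h N hN⟩

variable {V : MonoidVariety.{u}}

/-- `realize` turns `L` into the alternating product. A simple letter used in `L` cannot reappear
later, so `r` and `r'` become `x²y²` and `y²x²`. -/
theorem Holds.swapsAfterAlt (hV : ∀ (K : Type u) [Monoid K], V.Mem K → RepeatsLetters K)
    {T : ℕ → Prop} {L r r' : List ℕ} (h : V.Holds (L ++ r) (L ++ r')) {w z : ℕ} (hwz : w ≠ z)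
    (hw : ¬ T w) (hz : ¬ T z) (hT : ∀ t, T t → (L ++ r).count t = 1)
    (hT' : ∀ t, T t → (L ++ r').count t = 1) (hr : OccursBefore w z r) (hr' : OccursBefore z w r')
    {n : ℕ} (hn : Alternates T n w z L) (K : Type u) [Monoid K] (hK : V.Mem K) :
    SwapsAfterAlt K n := by
  intro x y g
  have H := hV K hK
  obtain ⟨θ, e1, e2, e3, e4⟩ := hn.realize (H.sq_mul_sq x) (H.sq_mul_sq y) hwz hw hz
    (fun t ht => by have := hT t ht; rw [List.count_append] at this; omega) g
  have hone : ∀ r : List ℕ, (∀ t, T t → (L ++ r).count t = 1) → ∀ c ∈ r, c ≠ w → c ≠ z →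
      θ c = 1 := by
    intro r hr c hc hcw hcz
    refine e3 c hcw hcz ?_
    by_contra! hcon
    have := hr c hcon.2
    rw [List.count_append] at this
    have := List.count_pos_iff.mpr hc
    have := List.count_pos_iff.mpr hcon.1
    omega
  have key := h K hK θ
  rw [evalWord_append, evalWord_append, e4, hr.evalWord_eq (hone r hT), e1, e2,
    hr'.evalWord_eq fun c hc h1 h2 => hone r' hT' c hc h2 h1, e1, e2] at key
  · exact key
  all_goals simp only [e1, e2, H.sq_mul_sq, H.sq_mul_sq_mul_sq]

/-- With `w ↦ x²`, `z ↦ y²`, `s ↦ g` and all else trivial, `P` becomes `x²y²`, up to exchanging `w`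
and `z`. -/
theorem Holds.swapsAfterBoth (hV : ∀ (K : Type u) [Monoid K], V.Mem K → RepeatsLetters K)
    {P r r' : List ℕ} {s w z : ℕ} (h : V.Holds (P ++ s :: r) (P ++ s :: r')) (hwz : w ≠ z)
    (hws : w ≠ s) (hzs : z ≠ s) (hs : (P ++ s :: r).count s = 1)
    (hs' : (P ++ s :: r').count s = 1) (hr : OccursBefore w z r) (hr' : OccursBefore z w r')
    (hw : w ∈ P) (hz : z ∈ P) (K : Type u) [Monoid K] (hK : V.Mem K) : SwapsAfterBoth K := by
  wlog hP : OccursBefore w z P generalizing w z r r'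
  · exact this h.symm hwz.symm hzs hws hs' hs hr' hr hz hw
      ((occursBefore_or hwz hw hz).resolve_left hP)
  intro x y g
  have H := hV K hK
  let θ : ℕ → K := fun c => if c = w then x ^ 2 else if c = z then y ^ 2 else if c = s then g else 1
  have e1 : θ w = x ^ 2 := if_pos rfl
  have e2 : θ z = y ^ 2 := by simp [θ, hwz.symm]
  have e3 : θ s = g := by simp [θ, hws.symm, hzs.symm]
  have hone : ∀ l : List ℕ, l.count s = 0 → ∀ c ∈ l, c ≠ w → c ≠ z → θ c = 1 := by
    intro l hl c hc hcw hcz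
    have : c ≠ s := by
      rintro rfl
      exact List.count_eq_zero.mp hl hc
    simp [θ, hcw, hcz, this]
  simp only [List.count_append, List.count_cons_self] at hs hs'
  have key := h K hK θ
  rw [evalWord_append, evalWord_append, evalWord_cons, evalWord_cons,
    hP.evalWord_eq (hone P (by omega)), hr.evalWord_eq (hone r (by omega)),
    hr'.evalWord_eq fun c hc h1 h2 => hone r' (by omega) c hc h2 h1, e1, e2, e3] at key
  · simpa [mul_assoc] using key
  all_goals simp only [e1, e2, H.sq_mul_sq, H.sq_mul_sq_mul_sq]

theorem not_swapsAfterAlt_zero : ¬ SwapsAfterAlt (WithOne SemigroupL₂.{u}) 0 := by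
  intro h
  have := h (some .a) (some .b) fun _ => 1
  simp only [altProd_zero, one_mul] at this
  cases this

/-- A reversal in one identity of `V` yields a law that swaps `w` and `z` for every continuation
`B`, `R` after `s`. If they share a `T`-free factor of `P` the law is σ_∞; otherwise they alternate
in `P` and it is σ_n, with n ≥ 1 because `L₂¹` violates commutation of squares. -/
theorem Holds.swap (hV : ∀ (K : Type u) [Monoid K], V.Mem K → RepeatsLetters K)
    (hL₂ : V.Mem (WithOne SemigroupL₂.{u})) {T : ℕ → Prop} {P r r' : List ℕ} {s w z : ℕ}
    (h : V.Holds (P ++ s :: r) (P ++ s :: r')) (hwz : w ≠ z) (hTs : T s)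
    (hw : ¬ T w) (hz : ¬ T z) (hT : ∀ t, T t → (P ++ s :: r).count t = 1)
    (hT' : ∀ t, T t → (P ++ s :: r').count t = 1) (hr : OccursBefore w z r)
    (hr' : OccursBefore z w r') {N : Type u} [Monoid N] (hN : RepeatsLetters N)
    (hVN : V.SwapsPassTo N) (θ : ℕ → N) {B R : List ℕ} (hwB : w ∉ B) (hzB : z ∉ B)
    (hcount : ∀ c, (P ++ s :: (B ++ ([w, w, z, z] ++ R))).count c = 1 → T c) :
    evalWord θ (P ++ s :: (B ++ ([w, w, z, z] ++ R))) =
      evalWord θ (P ++ s :: (B ++ ([z, z, w, w] ++ R))) := by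
  by_cases hP : ∀ A B C, P = A ++ (B ++ C) → (∀ c ∈ B, ¬ T c) → w ∈ B → z ∈ B → False
  · have key : ∀ l : List ℕ, P ++ s :: l = P ++ [s] ++ l := by simp
    obtain ⟨n, hn⟩ := Alternates.exists_or_exists hTs hw hz hP
    rw [key r, key r'] at h
    replace hT : ∀ t, T t → (P ++ [s] ++ r).count t = 1 := fun t ht => key r ▸ hT t ht
    replace hT' : ∀ t, T t → (P ++ [s] ++ r').count t = 1 := fun t ht => key r' ▸ hT' t ht
    have hK : ∀ (K : Type u) [Monoid K], V.Mem K → SwapsAfterAlt K n := by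
      rcases hn with hn | hn
      · exact h.swapsAfterAlt hV hwz hw hz hT hT' hr hr' hn
      · exact h.symm.swapsAfterAlt hV hwz.symm hz hw hT' hT hr' hr hn
    have h1 : 1 ≤ n := by
      rcases n with _ | n
      · exact absurd (hK _ hL₂) not_swapsAfterAlt_zero
      · omega
    rcases hn with hn | hn
    · have := hN.swap_of_alternates (hVN.alt n h1 hK) (hn.append hwB hzB) θ R
      simpa only [List.append_assoc, List.cons_append, List.nil_append] using this
    · have := hN.swap_of_alternates (hVN.alt n h1 hK) (hn.append hzB hwB) θ R
      simpa only [List.append_assoc, List.cons_append, List.nil_append] using this.symm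
  · push Not at hP
    obtain ⟨A, D, C, rfl, hD, hwD, hzD, -⟩ := hP
    have hK : ∀ (K : Type u) [Monoid K], V.Mem K → SwapsAfterBoth K :=
      h.swapsAfterBoth hV hwz (fun e => hw (e ▸ hTs)) (fun e => hz (e ▸ hTs)) (hT s hTs)
        (hT' s hTs) hr hr' (by simp [hwD]) (by simp [hzD])
    have := hN.swap_of_mem_factor (A := A) (B := D) (C := C ++ s :: B) (hVN.both hK) hwD hzD θ R (by
      intro c hc
      have h1 : _ ≠ 1 := fun e => hD c hc (hcount c e)
      have h2 := List.count_pos_iff.mpr hc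
      simp only [List.append_assoc, List.cons_append] at h1 ⊢
      simp only [List.count_append] at h1 ⊢
      omega)
    simpa using this

end MonoidVariety

/-! ### Deriving every identity of `V` from the swapping laws. -/

namespace MonoidVariety

variable {V : MonoidVariety.{u}}

/-- The left side is rewritten into the right one letter by letter: `s` opens the current block, `B`
is the part of it already matched, and `t` is a simple end marker. -/
theorem Holds.transfer (hV : ∀ (K : Type u) [Monoid K], V.Mem K → RepeatsLetters K)
    (hQ : V.Mem (WithOne SemigroupQ.{u})) (hL₂ : V.Mem (WithOne SemigroupL₂.{u}))
    {M : Type u} [Monoid M] (hM : RepeatsLetters M) (hVM : V.SwapsPassTo M) {t : ℕ}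
    (v : List ℕ) : ∀ (P : List ℕ) (s : ℕ) (B u : List ℕ), (∀ c ∈ B, 2 ≤ B.count c) →
    (P ++ s :: (B ++ (v ++ [t]))).count s = 1 → (P ++ s :: (B ++ (v ++ [t]))).count t = 1 →
    V.Holds (P ++ s :: (B ++ (u ++ [t]))) (P ++ s :: (B ++ (v ++ [t]))) →
    ∀ θ : ℕ → M, evalWord θ (P ++ s :: (B ++ (u ++ [t]))) =
      evalWord θ (P ++ s :: (B ++ (v ++ [t]))) := by
  -- Rewriting steps are proved for any suitable `N`: they apply to `M`, and also to the members of
  -- `V`, so the remaining identity still holds in `V`.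
  have step : ∀ {a b : List ℕ}, (∀ (N : Type u) [Monoid N], RepeatsLetters N →
      V.SwapsPassTo N → ∀ θ : ℕ → N, evalWord θ a = evalWord θ b) → V.Holds a b :=
    fun h N _ hN => h N (hV N hN) (swapsPassTo_of_mem hN)
  induction v with
  | nil =>
    intro P s B u hB hs ht h θ
    have hs' := h.count_eq_one hQ hs
    have ht' := h.count_eq_one hQ ht
    have hu : ∀ c ∈ u, c ∈ B := by
      intro c hc
      have h' : V.Holds (P ++ s :: (B ++ t :: [])) (P ++ s :: ((B ++ u) ++ t :: [])) := by
        simpa using h.symm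
      exact h'.mem_between hQ (by simpa using hs') (by simpa using ht') (by simp [hc])
    have := hM.insert_list θ (A := P ++ [s]) (C := [t]) hu fun c hc => (hB c hc).trans (by
      simp only [List.count_append]
      omega)
    simpa only [List.append_assoc, List.cons_append, List.nil_append] using this.symm
  | cons z v ih =>
    intro P s B u hB hs ht h θ
    have hs' := h.count_eq_one hQ hs
    have ht' := h.count_eq_one hQ ht
    -- A simple `z` opens a new block; the letters of `u` before it all lie in `B` and are
    -- redundant.
    by_cases hz1 : (P ++ s :: (B ++ (z :: v ++ [t]))).count z = 1
    · have hz1' := h.count_eq_one hQ hz1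
      have hzu : z ∈ u := by
        simp only [List.count_append, List.count_cons, List.count_nil, beq_self_eq_true,
          if_true, List.cons_append] at hz1 hz1'
        exact List.count_pos_iff.mp (by omega)
      obtain ⟨u₁, u₂, rfl⟩ := List.append_of_mem hzu
      have hu : ∀ c ∈ u₁, c ∈ B := by
        intro c hc
        have h' : V.Holds (P ++ s :: (B ++ z :: (v ++ [t])))
            (P ++ s :: ((B ++ u₁) ++ z :: (u₂ ++ [t]))) := by
          simpa using h.symm
        exact h'.mem_between hQ (by simpa using hs') (by simpa using hz1') (by simp [hc])
      have hstep : ∀ (N : Type u) [Monoid N], RepeatsLetters N → ∀ θ : ℕ → N,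
          evalWord θ (P ++ s :: B ++ z :: ([] ++ (u₂ ++ [t]))) =
            evalWord θ (P ++ s :: (B ++ (u₁ ++ z :: u₂ ++ [t]))) := by
        intro N _ hN θ
        have := hN.insert_list θ (A := P ++ [s]) (C := z :: (u₂ ++ [t])) hu
          fun c hc => (hB c hc).trans (by
            simp only [List.count_append]
            omega)
        simpa only [List.append_assoc, List.cons_append, List.nil_append] using this
      have e : P ++ s :: (B ++ (z :: v ++ [t])) = P ++ s :: B ++ z :: ([] ++ (v ++ [t])) := by simp
      rw [e] at hz1 ht h ⊢
      rw [← hstep M hM θ]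
      exact ih (P ++ s :: B) z [] u₂ (by simp) hz1 ht
        ((step fun N _ hN _ => hstep N hN).trans h) θ
    · have hzs : z ≠ s := by
        rintro rfl
        exact hz1 hs
      have hzt : z ≠ t := by
        rintro rfl
        exact hz1 ht
      have hcount : ∀ c, c ≠ z → (P ++ s :: (B ++ (z :: v ++ [t]))).count c =
          (P ++ s :: (B ++ (v ++ [t]))).count c := by
        intro c hc
        simp [List.count_cons, hc.symm]
      -- A non-simple `z` already present in `B` can be erased from the target.
      by_cases hzB : z ∈ B
      · have hstep : ∀ (N : Type u) [Monoid N], RepeatsLetters N → ∀ θ : ℕ → N,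
            evalWord θ (P ++ s :: (B ++ (v ++ [t]))) =
              evalWord θ (P ++ s :: (B ++ (z :: v ++ [t]))) := by
          intro N _ hN θ
          have := hN (P ++ [s]) B (v ++ [t]) z θ hzB fun c hc => (hB c hc).trans (by
            simp only [List.count_append]
            omega)
          simpa only [List.append_assoc, List.cons_append, List.nil_append] using this
        rw [← hstep M hM θ]
        refine ih P s B u hB ?_ ?_ (h.trans (step fun N _ hN _ => hstep N hN).symm) θ
        · rw [← hcount s hzs.symm, hs]
        · rw [← hcount t hzt.symm, ht]
      · let T : ℕ → Prop := fun c => (P ++ s :: (B ++ (u ++ [t]))).count c = 1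
        -- Here `z` is new in its block. The letter `t'` ends this block in `u`, so `z` must occur
        -- before it.
        rcases List.exists_first_or_forall_not T (u ++ [t]) with
          hall | ⟨u₁', t', u₂', hut, ht1, hu₁'⟩
        · exact absurd ht' (hall t (by simp))
        have hT' : ∀ c, T c → (P ++ s :: (B ++ (z :: v ++ [t]))).count c = 1 :=
          fun c hc => h.symm.count_eq_one hQ hc
        have hTz : ¬ T z := fun hz => hz1 (hT' z hz)
        have ht'v : t' ∈ v ++ [t] := by
          have h1 := hT' t' ht1
          have hzt' : z ≠ t' := fun e => hTz (e ▸ ht1)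
          have h2 : (P ++ s :: (B ++ (u ++ [t]))).count t' = 1 := ht1
          rw [hut] at h2
          rw [hcount t' hzt'.symm] at h1
          simp only [List.count_append, List.count_cons, beq_self_eq_true, if_true] at h1 h2
          refine List.count_pos_iff.mp ?_
          simp only [List.count_append, List.count_cons]
          omega
        obtain ⟨v₁, v₂, hv⟩ := List.append_of_mem ht'v
        have hzu₁ : z ∈ u₁' := by
          have e1 : P ++ s :: (B ++ (u ++ [t])) = P ++ s :: ((B ++ u₁') ++ t' :: u₂') := by
            simp [hut]
          have e2 : P ++ s :: (B ++ (z :: v ++ [t])) = P ++ s :: ((B ++ z :: v₁) ++ t' :: v₂) := by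
            simp [hv]
          have h1 := hT' t' ht1
          rw [e2] at h1 hs
          rw [e1, e2] at h
          have := h.mem_between hQ hs h1 (x := z) (by simp)
          simpa [hzB] using this
        obtain ⟨u₁, u₃, rfl, hzu⟩ := List.exists_first_mem hzu₁
        have hut' : u ++ [t] = u₁ ++ z :: (u₃ ++ t' :: u₂') := by simp [hut]
        generalize u₃ ++ t' :: u₂' = R at hut'
        -- On the left `w` precedes `z`, on the right `z` comes directly after `B`: the reversal
        -- needed by `Holds.swap`.
        have hswap : ∀ (N : Type u) [Monoid N], RepeatsLetters N → V.SwapsPassTo N →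
            ∀ (θ : ℕ → N), ∀ w ∈ u₁, w ∉ B → ∀ B' R' : List ℕ, (∀ c ∈ B', ¬ T c) → w ∉ B' →
            z ∉ B' → (∀ c, (P ++ [s] ++ (B' ++ ([w, w, z, z] ++ R'))).count c = 1 → T c) →
            evalWord θ (P ++ [s] ++ (B' ++ ([w, w, z, z] ++ R'))) =
              evalWord θ (P ++ [s] ++ (B' ++ ([z, z, w, w] ++ R'))) := by
          intro N _ hN hVN θ w hw hwB B' R' _ hwB' hzB' hc
          have hTw : ¬ T w := hu₁' w (by simp [hw])
          have hwz : w ≠ z := ne_of_mem_of_not_mem hw hzu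
          have hwt : w ≠ t := fun e => hTw (e ▸ ht')
          have hwu : w ∈ u := by
            have : w ∈ u ++ [t] := by simp [hut', hw]
            simpa [hwt] using this
          have hwv : w ∈ v := by
            have h' : V.Holds (P ++ s :: ((B ++ z :: v) ++ t :: []))
                (P ++ s :: ((B ++ u) ++ t :: [])) := by
              simpa using h.symm
            have := h'.mem_between hQ (by simpa using hs') (by simpa using ht')
              (x := w) (by simp [hwu])
            simpa [hwB, hwz] using this
          have hr : OccursBefore w z (B ++ (u ++ [t])) := by
            obtain ⟨A₁, C₁, rfl⟩ := List.append_of_mem hw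
            refine ⟨B ++ A₁, C₁ ++ z :: R, by simp [hut'], ?_, by simp⟩
            simp only [List.mem_append, not_or] at hzu ⊢
            exact ⟨hzB, hzu.1⟩
          have hr' : OccursBefore z w (B ++ (z :: v ++ [t])) :=
            ⟨B, v ++ [t], rfl, hwB, by simp [hwv]⟩
          have := h.swap hV hL₂ (T := T) hwz hs' hTw hTz (fun _ => id) hT' hr hr' hN hVN θ hwB' hzB'
            (R := R') (fun c hc' => hc c (by simpa using hc'))
          simpa only [List.append_assoc, List.cons_append, List.nil_append] using this
        have hz2 : 2 ≤ (P ++ s :: (B ++ (u ++ [t]))).count z := by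
          have h1 : (P ++ s :: (B ++ (u ++ [t]))).count z ≠ 1 := hTz
          have h2 : 0 < (P ++ s :: (B ++ (u ++ [t]))).count z :=
            List.count_pos_iff.mpr (by simp [hut'])
          omega
        have hstep : ∀ (N : Type u) [Monoid N], RepeatsLetters N → V.SwapsPassTo N →
            ∀ θ : ℕ → N, evalWord θ (P ++ s :: (B ++ (u ++ [t]))) =
              evalWord θ (P ++ s :: (B ++ [z, z] ++ (u ++ [t]))) := by
          intro N _ hN hVN θ
          have hmove := hN.move_left θ (L := P ++ [s]) (R := z :: R) hTz u₁ B
            (fun c hc hTc => by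
              have h1 : (P ++ s :: (B ++ (u ++ [t]))).count c = 1 := hTc
              have h2 := hB c hc
              simp only [List.count_append, List.count_cons] at h1
              omega)
            (fun c hc => hu₁' c (by simp [hc])) hzB hzu
            (fun c hc => by
              change (P ++ s :: (B ++ (u ++ [t]))).count c = 1
              rw [hut']
              by_cases hcz : c = z
              · subst hcz
                simp only [List.count_append, List.count_cons_self] at hc
                omega
              · simp only [List.count_append, List.count_cons, List.count_nil, beq_iff_eq,
                  if_neg (Ne.symm hcz)] at hc ⊢
                omega)
            (hswap N hN hVN θ)
          rw [hut'] at hz2 ⊢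
          have e1 := hN.insert_adjacent θ (A := P ++ s :: (B ++ u₁)) (C := R) (w := z)
            (by simpa using hz2)
          have e2 := hN.insert_adjacent θ (A := P ++ s :: (B ++ u₁)) (C := z :: R) (w := z) (by
            simp only [List.count_append, List.count_cons_self]
            omega)
          simp only [List.append_assoc, List.cons_append, List.nil_append] at hmove e1 e2 ⊢
          rw [e1, e2, hmove]
        have hstep' : ∀ (N : Type u) [Monoid N], RepeatsLetters N → ∀ θ : ℕ → N,
            evalWord θ (P ++ s :: (B ++ [z, z] ++ (v ++ [t]))) =
              evalWord θ (P ++ s :: (B ++ (z :: v ++ [t]))) := by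
          intro N _ hN θ
          have hz2' : 2 ≤ (P ++ s :: (B ++ (z :: v ++ [t]))).count z := by
            have h2 : 0 < (P ++ s :: (B ++ (z :: v ++ [t]))).count z :=
              List.count_pos_iff.mpr (by simp)
            omega
          have := hN.insert_adjacent θ (A := P ++ s :: B) (C := v ++ [t]) (w := z)
            (by simpa using hz2')
          simpa only [List.append_assoc, List.cons_append, List.nil_append] using this.symm
        rw [hstep M hM hVM θ, ← hstep' M hM θ]
        have hcount' : ∀ c, c ≠ z → (P ++ s :: (B ++ (z :: v ++ [t]))).count c =
            (P ++ s :: (B ++ [z, z] ++ (v ++ [t]))).count c := by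
          intro c hc
          simp [List.count_cons, hc.symm]
        -- Two copies of `z` keep every letter of `B` repeated within `B`; the left side retains all
        -- of `u`.
        refine ih P s (B ++ [z, z]) u ?_ ?_ ?_ ?_ θ
        · intro c hc
          by_cases hcz : c = z
          · simp [hcz]
          · have hc' : c ∈ B := by simpa [hcz] using hc
            exact (hB c hc').trans (by simp)
        · rw [← hcount' s hzs.symm, hs]
        · rw [← hcount' t hzt.symm, ht]
        · exact (step fun N _ hN hVN => hstep N hN hVN).symm.trans
            (h.trans (step fun N _ hN _ => hstep' N hN).symm)

theorem mem_of_swapsPassTo (hV : ∀ (K : Type u) [Monoid K], V.Mem K → RepeatsLetters K)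
    (hQ : V.Mem (WithOne SemigroupQ.{u})) (hL₂ : V.Mem (WithOne SemigroupL₂.{u}))
    {M : Type u} [Monoid M] (hM : RepeatsLetters M) (hVM : V.SwapsPassTo M) : V.Mem M := by
  refine V.mem_of_identities M fun a b hab θ => ?_
  -- Fresh letters `s` and `t` serve as simple end markers and are finally sent to 1.
  obtain ⟨s, hs⟩ := Infinite.exists_notMem_finset (a ++ b).toFinset
  obtain ⟨t, ht⟩ := Infinite.exists_notMem_finset (s :: (a ++ b)).toFinset
  simp only [List.mem_toFinset, List.mem_append, List.mem_cons, not_or] at hs ht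
  have h : V.Holds ([] ++ s :: ([] ++ (a ++ [t]))) ([] ++ s :: ([] ++ (b ++ [t]))) := by
    intro K _ hK τ
    simp [hab K hK τ]
  have := h.transfer hV hQ hL₂ hM hVM b [] s [] a (by simp)
    (by simp [List.count_eq_zero.mpr hs.2, ht.1])
    (by simp [List.count_eq_zero.mpr ht.2.2, Ne.symm ht.1])
    (fun c => if c = s ∨ c = t then 1 else θ c)
  have hcongr : ∀ l : List ℕ, s ∉ l → t ∉ l →
      evalWord (fun c => if c = s ∨ c = t then 1 else θ c) l = evalWord θ l := by
    intro l h1 h2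
    refine evalWord_congr fun c hc => if_neg ?_
    rintro (rfl | rfl) <;> contradiction
  simpa [hcongr a hs.1 ht.2.1, hcongr b hs.2 ht.2.2] using this

end MonoidVariety

/-! ### An automaton for the words equal to the left side of σ_n in `E¹`. -/

theorem map_evalWord {M N : Type*} [Monoid M] [Monoid N] (f : M →* N) (θ : ℕ → M) (l : List ℕ) :
    f (evalWord θ l) = evalWord (fun i => f (θ i)) l := by
  simp [evalWord, map_list_prod, Function.comp_def]

theorem map_altProd {M N : Type*} [Monoid M] [Monoid N] (f : M →* N) (n : ℕ) (x y : M)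
    (h : ℕ → M) : f (altProd n x y h) = altProd n (f x) (f y) fun i => f (h i) := by
  induction n generalizing x y h with
  | zero => simp
  | succ n ih => simp [altProd_succ, ih]

/-- The letter `c` may be read in state `s`, leading to state `s'`, by the automaton accepting
the words with blocks like those of the left-hand side of `sigma n`. -/
def BlockStep (n s c s' : ℕ) : Prop :=
  (c = s + 2 ∧ s < n ∧ s' = s + 1) ∨ (s' = s ∧ c < 2 ∧ (s < n → c = s % 2))

/-- `BlockRun n s l s'` says that reading `l` leads from state `s` to state `s'`. -/
inductive BlockRun (n : ℕ) : ℕ → List ℕ → ℕ → Prop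
  | nil (s : ℕ) : BlockRun n s [] s
  | snoc {s s' s'' c : ℕ} {l : List ℕ} : BlockRun n s l s' → BlockStep n s' c s'' →
      BlockRun n s (l ++ [c]) s''

namespace BlockRun

variable {n s s' : ℕ} {l l' : List ℕ}

theorem trans {s'' : ℕ} (h : BlockRun n s l s') (h' : BlockRun n s' l' s'') :
    BlockRun n s (l ++ l') s'' := by
  induction h' with
  | nil => simpa using h
  | snoc _ hstep ih =>
    rw [← List.append_assoc]
    exact ih.snoc hstep

theorem of_step {c : ℕ} (h : BlockStep n s c s') : BlockRun n s [c] s' :=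
  BlockRun.snoc (.nil s) h

theorem exists_of_append (h : BlockRun n s (l ++ l') s') :
    ∃ r, BlockRun n s l r ∧ BlockRun n r l' s' := by
  generalize hL : l ++ l' = L at h
  induction h generalizing l l' with
  | nil =>
    obtain ⟨rfl, rfl⟩ := List.append_eq_nil_iff.mp hL
    exact ⟨s, .nil s, .nil s⟩
  | @snoc s' s'' c L h hstep ih =>
    rcases List.eq_nil_or_concat l' with rfl | ⟨l'', d, rfl⟩
    · refine ⟨s'', ?_, .nil _⟩
      rw [List.append_nil] at hL
      subst hL
      exact h.snoc hstep
    · rw [List.concat_eq_append, ← List.append_assoc] at hL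
      obtain ⟨h1, h2⟩ := List.append_inj' hL rfl
      obtain ⟨r, hr, hr'⟩ := ih h1
      cases h2
      exact ⟨r, hr, by simpa using hr'.snoc hstep⟩

theorem le (h : BlockRun n s l s') : s ≤ s' := by
  induction h with
  | nil => exact le_rfl
  | snoc _ hstep ih => rcases hstep with h | h <;> omega

theorem le_of_le (h : BlockRun n s l s') (hs : s ≤ n) : s' ≤ n := by
  induction h with
  | nil => exact hs
  | snoc _ hstep ih => rcases hstep with h | h <;> omega

theorem of_mem (h : BlockRun n s l s') {c : ℕ} (hc : c ∈ l) :
    (s + 2 ≤ c ∧ c < s' + 2) ∨ c < 2 := by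
  induction h with
  | nil => simp at hc
  | @snoc s' s'' d l h hstep ih =>
    have := h.le
    rw [List.mem_append, List.mem_singleton] at hc
    rcases hc with hc | rfl
    · rcases ih hc with h | h <;> rcases hstep with h' | h' <;> omega
    · rcases hstep with h' | h' <;> omega

theorem eq_of_lt_two (h : BlockRun n s l s') (hl : ∀ c ∈ l, c < 2) :
    s' = s ∧ (s < n → ∀ c ∈ l, c = s % 2) := by
  induction h with
  | nil => simp
  | @snoc s' s'' d l h hstep ih =>
    obtain ⟨rfl, h2⟩ := ih fun c hc => hl c (by simp [hc])
    have hd := hl d (by simp)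
    rcases hstep with h' | ⟨rfl, -, h'⟩
    · omega
    · refine ⟨rfl, fun hs c hc => ?_⟩
      rw [List.mem_append, List.mem_singleton] at hc
      rcases hc with hc | rfl
      · exact h2 hs c hc
      · exact h' hs

/-- A run reads each separator at most once, so a square contains none and stays in one block; every
block before the last admits a single letter. -/
theorem of_append_self (h : BlockRun n s (l ++ l) s') :
    s' = s ∧ (∀ c ∈ l, c < 2) ∧ (s < n → ∀ c ∈ l, c = s % 2) := by
  have hl : ∀ c ∈ l, c < 2 := by
    intro c hc
    obtain ⟨r, h1, h2⟩ := h.exists_of_append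
    have := h1.of_mem hc
    have := h2.of_mem hc
    omega
  obtain ⟨rfl, h2⟩ := h.eq_of_lt_two (by simpa [or_imp, forall_and] using hl)
  exact ⟨rfl, hl, fun hs c hc => h2 hs c (by simp [hc])⟩

theorem lt_two_of_top (h : BlockRun n n l s') : ∀ c ∈ l, c < 2 := by
  intro c hc
  have := h.of_mem hc
  have := h.le_of_le le_rfl
  omega

theorem or_exists_stuck (n : ℕ) (l : List ℕ) :
    (∃ s, BlockRun n 0 l s) ∨
      ∃ A c B s, l = A ++ c :: B ∧ BlockRun n 0 A s ∧ ∀ s', ¬ BlockStep n s c s' := by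
  induction l using List.reverseRecOn with
  | nil => exact Or.inl ⟨0, .nil 0⟩
  | append_singleton l d ih =>
    rcases ih with ⟨s, hs⟩ | ⟨A, c, B, s, rfl, h1, h2⟩
    · by_cases h : ∃ s', BlockStep n s d s'
      · obtain ⟨s', hs'⟩ := h
        exact Or.inl ⟨s', hs.snoc hs'⟩
      · push Not at h
        exact Or.inr ⟨l, d, [], s, by simp, hs, h⟩
    · exact Or.inr ⟨A, c, B ++ [d], s, by simp, h1, h2⟩

end BlockRun

namespace SemigroupE

theorem evalWord_of_repeat {n s j : ℕ} {l : List ℕ} (h : BlockRun n 0 l s) :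
    evalWord (fun i => if i = j + 2 then ((a : SemigroupE.{u}) : WithOne SemigroupE.{u}) else 1) l =
      if j < s then ((a : SemigroupE) : WithOne SemigroupE) else 1 := by
  induction h with
  | nil => simp
  | @snoc s s' c l h hstep ih =>
    rw [evalWord_append, ih, evalWord_cons, evalWord_nil, mul_one]
    rcases hstep with ⟨rfl, -, rfl⟩ | ⟨rfl, hc, -⟩
    · rcases lt_trichotomy j s with hj | rfl | hj
      · rw [if_pos hj, if_neg (by omega), if_pos (by omega), mul_one]
      · rw [if_neg (by omega), if_pos rfl, if_pos (by omega), one_mul]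
      · rw [if_neg (by omega), if_neg (by omega), if_neg (by omega), mul_one]
    · rw [if_neg (by omega : c ≠ j + 2), mul_one]

/-- The element `a` of `E¹`. -/
abbrev elA : WithOne SemigroupE.{u} := ((a : SemigroupE.{u}) : WithOne SemigroupE.{u})

/-- The element `ac` of `E¹`. -/
abbrev elAC : WithOne SemigroupE.{u} := ((ac : SemigroupE.{u}) : WithOne SemigroupE.{u})

/-- The element `b` of `E¹`. -/
abbrev elB : WithOne SemigroupE.{u} := ((b : SemigroupE.{u}) : WithOne SemigroupE.{u})

/-- The element `c` of `E¹`. -/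
abbrev elC : WithOne SemigroupE.{u} := ((c : SemigroupE.{u}) : WithOne SemigroupE.{u})

/-- A substitution detecting a letter `w` in the block number `s`. -/
def detect (s w : ℕ) (i : ℕ) : WithOne SemigroupE.{u} :=
  if i = s + 2 then elC else if i = w then elB
  else if i = s + 1 ∧ s ≠ 0 then elA else 1

/-- The value records whether block `s` is ahead (1 or `b`), current (`a`) or past (`ac`). Block 0
has no opening separator, so there `p` supplies the initial `a`. -/
theorem detect_run {n s w : ℕ} (hsn : s < n) (hw : ∀ s', ¬ BlockStep n s w s')
    (hws : s ≠ 0 → w ≠ s + 1) {r : ℕ} {l : List ℕ} (h : BlockRun n 0 l r) :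
    ∀ p : WithOne SemigroupE.{u}, p = (if s = 0 then elA else 1) →
    (r < s → p * evalWord (detect s w) l = 1 ∨ p * evalWord (detect s w) l = elB) ∧
    (r = s → p * evalWord (detect s w) l = elA) ∧
    (s < r → p * evalWord (detect s w) l = elAC) := by
  intro p hp
  have hw2 : w ≠ s + 2 := fun e => hw (s + 1) (Or.inl ⟨e, hsn, rfl⟩)
  induction h with
  | nil =>
    rw [evalWord_nil, mul_one, hp]
    refine ⟨fun h => ?_, fun h => if_pos h.symm, fun h => by omega⟩
    rw [if_neg (by omega)]
    exact Or.inl rfl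
  | @snoc r r' c l h hstep ih =>
    obtain ⟨ih1, ih2, ih3⟩ := ih
    rw [evalWord_append, evalWord_cons, evalWord_nil, mul_one, ← mul_assoc]
    generalize p * evalWord (detect s w) l = q at ih1 ih2 ih3
    have hcw : r = s → c ≠ w := by
      rintro rfl rfl
      exact hw _ hstep
    rcases lt_trichotomy r s with hr | rfl | hr
    · have hc2 : c ≠ s + 2 := by rcases hstep with h | h <;> omega
      by_cases hr' : r' = s
      · have hc : c = s + 1 := by rcases hstep with h | h <;> omega
        have hs0 : s ≠ 0 := by omega
        have : detect.{u} s w c = elA := by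
          rw [detect, if_neg hc2, if_neg (hc ▸ (hws hs0).symm), if_pos ⟨hc, hs0⟩]
        rw [this]
        refine ⟨fun h => by omega, fun _ => ?_, fun h => by omega⟩
        rcases ih1 hr with rfl | rfl <;> rfl
      · have hc : ¬ (c = s + 1 ∧ s ≠ 0) := by rcases hstep with h | h <;> omega
        have : detect.{u} s w c = elB ∨ detect.{u} s w c = 1 := by
          rw [detect, if_neg hc2, if_neg hc]
          split_ifs
          · exact Or.inl rfl
          · exact Or.inr rfl
        refine ⟨fun _ => ?_, fun h => by omega, fun h => by
          rcases hstep with h | h <;> omega⟩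
        rcases ih1 hr with rfl | rfl <;> rcases this with h | h <;> rw [h]
        exacts [Or.inr rfl, Or.inl rfl, Or.inr rfl, Or.inr rfl]
    · rw [ih2 rfl]
      rcases hstep with ⟨rfl, -, rfl⟩ | ⟨rfl, hc, hc'⟩
      · refine ⟨fun h => by omega, fun h => by omega, fun _ => ?_⟩
        rw [detect, if_pos rfl]
        rfl
      · refine ⟨fun h => by omega, fun _ => ?_, fun h => by omega⟩
        have hc1 : ¬ (c = r' + 1 ∧ r' ≠ 0) := by omega
        rw [detect, if_neg (by omega), if_neg (hcw rfl), if_neg hc1, mul_one]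
    · rw [ih3 hr]
      refine ⟨fun h => by rcases hstep with h | h <;> omega,
        fun h => by rcases hstep with h | h <;> omega, fun _ => ?_⟩
      have hc1 : ¬ (c = s + 1 ∧ s ≠ 0) := by rcases hstep with h | h <;> omega
      rw [detect, if_neg hc1]
      split_ifs <;> rfl

/-- Suppose the run gets stuck at `w`. A repeated or foreign separator is exposed by sending it to
`a` alone; any other `w` is illegal in a block `s < n`, and `detect` gives `ab = 0` on the word but
`ac` on `G`. -/
theorem exists_blockRun_of_evalWord_eq {n : ℕ} {G l : List ℕ} (hG : BlockRun n 0 G n)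
    (h : ∀ θ : ℕ → WithOne SemigroupE.{u}, evalWord θ l = evalWord θ G) :
    ∃ s, BlockRun n 0 l s := by
  refine (BlockRun.or_exists_stuck n l).resolve_right ?_
  rintro ⟨A, w, B, s, rfl, hA, hw⟩
  have hsn := hA.le_of_le (Nat.zero_le n)
  have hrep : ∀ j, w = j + 2 → j < s ∨ n ≤ j → False := by
    rintro j rfl hj
    have key := h fun i => if i = j + 2 then ((a : SemigroupE.{u}) : WithOne SemigroupE.{u}) else 1
    rw [evalWord_append, evalWord_cons, evalWord_of_repeat hA, evalWord_of_repeat hG,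
      if_pos rfl] at key
    generalize evalWord (M := WithOne SemigroupE.{u}) _ B = q at key
    rcases hj with hj | hj
    · rw [if_pos hj, if_pos (by omega), ← mul_assoc] at key
      rw [show ((a : SemigroupE.{u}) : WithOne SemigroupE.{u}) * ((a : SemigroupE.{u}) :
        WithOne SemigroupE.{u}) = ((zero : SemigroupE) : WithOne SemigroupE) from rfl,
        zero_mul'] at key
      cases key
    · rw [if_neg (by omega), if_neg (by omega), one_mul] at key
      have : InIdeal (((a : SemigroupE.{u}) : WithOne SemigroupE.{u}) * q) :=
        InIdeal.mul_right (Or.inr (Or.inl rfl)) q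
      rw [key] at this
      rcases this with h | h | h <;> cases h
  by_cases hws : s < n ∧ (s ≠ 0 → w ≠ s + 1)
  · have h1 := (detect_run.{u} hws.1 hw hws.2 hA _ rfl).2.1 rfl
    have h2 := (detect_run.{u} hws.1 hw hws.2 hG _ rfl).2.2 hws.1
    rw [← h, evalWord_append, evalWord_cons, ← mul_assoc, h1] at h2
    have hw2 : w ≠ s + 2 := fun e => hw (s + 1) (Or.inl ⟨e, hws.1, rfl⟩)
    rw [detect, if_neg hw2, if_pos rfl, ← mul_assoc] at h2
    rw [show (elA.{u} * elB.{u}) =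
      ((zero : SemigroupE) : WithOne SemigroupE) from rfl, zero_mul'] at h2
    cases h2
  · by_cases hs : s < n
    · have : s ≠ 0 ∧ w = s + 1 := by
        by_contra hcon
        exact hws ⟨hs, fun h1 h2 => hcon ⟨h1, h2⟩⟩
      exact hrep (s - 1) (by omega) (by omega)
    · have hw2 : 2 ≤ w := by
        by_contra hcon
        exact hw s (Or.inr ⟨rfl, by omega, fun h => by omega⟩)
      exact hrep (w - 2) (by omega) (by omega)

end SemigroupE

/-- A run through `altProd (m + 1) (X ^ 2) (Y ^ 2) H`, where `X` and `Y` are not powers of the same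
letter, reaches the last state before its last square unless it started at least `m` states
before that state. -/
theorem BlockRun.altProd_cases {n : ℕ} (m : ℕ) : ∀ {s f : ℕ} {X Y : FreeMonoid ℕ}
    (H : ℕ → FreeMonoid ℕ),
    (¬ ∃ d, (∀ c ∈ X.toList, c = d) ∧ ∀ c ∈ Y.toList, c = d) → s ≤ n →
    BlockRun n s (altProd (m + 1) (X ^ 2) (Y ^ 2) H).toList f →
    s + m < n ∨ ∃ g Z K : FreeMonoid ℕ, altProd (m + 1) (X ^ 2) (Y ^ 2) H = g * Z ^ 2 * K ∧
      (Z = X ∨ Z = Y) ∧ ∀ c ∈ K.toList, c < 2 := by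
  induction m with
  | zero =>
    intro s f X Y H _ hs h
    rcases hs.lt_or_eq with hs | rfl
    · exact Or.inl hs
    · refine Or.inr ⟨1, X, H 0, by simp [altProd_succ], Or.inl rfl, fun c hc => ?_⟩
      exact h.lt_two_of_top c (by simp [altProd_succ, hc])
  | succ m ih =>
    intro s f X Y H hXY hs h
    rw [altProd_succ, FreeMonoid.toList_mul, FreeMonoid.toList_mul, sq, FreeMonoid.toList_mul] at h
    obtain ⟨s₂, h1, h2⟩ := h.exists_of_append
    have hs₂ := h1.le_of_le hs
    obtain ⟨s₁, h3, h4⟩ := h1.exists_of_append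
    obtain ⟨rfl, -, h5⟩ := h3.of_append_self
    rcases ih (fun i => H (i + 1)) (fun ⟨d, h1, h2⟩ => hXY ⟨d, h2, h1⟩) hs₂ h2 with
      h6 | ⟨g, Z, K, h6, h7, h8⟩
    · left
      rw [altProd_succ, FreeMonoid.toList_mul, FreeMonoid.toList_mul, sq, FreeMonoid.toList_mul,
        List.append_assoc] at h2
      obtain ⟨s₃, h7, -⟩ := h2.exists_of_append
      have h8 := h7.of_append_self.2.2 (by omega)
      have h9 := h4.le
      have h10 : s₁ ≠ s₂ := by
        rintro rfl
        exact hXY ⟨_, h5 (by omega), h8⟩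
      omega
    · exact Or.inr ⟨X ^ 2 * H 0 * g, Z, K, by rw [altProd_succ, h6]; simp only [mul_assoc],
        h7.symm, h8⟩

namespace SemigroupE

theorem not_inIdeal_sq_mul {p q : WithOne SemigroupE.{u}} (hp : ¬ InIdeal p) (hp1 : p ≠ 1)
    (hq : ¬ InIdeal q) : p ^ 2 * q = p ^ 2 := by
  rw [sq]
  rcases not_inIdeal hp with rfl | rfl | rfl <;> rcases not_inIdeal hq with rfl | rfl | rfl <;>
    first | rfl | exact absurd rfl hp1

theorem InIdeal.sq {p : WithOne SemigroupE.{u}} (hp : InIdeal p) :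
    p ^ 2 = ((zero : SemigroupE) : WithOne SemigroupE) := by
  rw [_root_.sq, hp.mul_eq_zero hp]

/-- Powers of one letter commute. Otherwise n + 1 alternating squares reach the last block, where
some `Z²` with `Z` equal to `X` or `Y` is followed only by letters x, y. Then either a value in the
ideal makes `X²` or `Y²` zero, or all values lie in `{1, b, c}` and `Z²` absorbs what follows,
unless `Z` has value 1 and the swap is trivial. -/
theorem evalWord_swap_of_blockRun {n : ℕ} {A : List ℕ} {X Y : FreeMonoid ℕ}
    {H : ℕ → FreeMonoid ℕ} {f : ℕ} (hn : 1 ≤ n)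
    (h : BlockRun n 0 (A ++ (altProd (n + 1) (X ^ 2) (Y ^ 2) H).toList) f)
    (θ : ℕ → WithOne SemigroupE.{u}) :
    evalWord θ (altProd (n + 1) (X ^ 2) (Y ^ 2) H).toList *
        (evalWord θ X.toList ^ 2 * evalWord θ Y.toList ^ 2) =
      evalWord θ (altProd (n + 1) (X ^ 2) (Y ^ 2) H).toList *
        (evalWord θ Y.toList ^ 2 * evalWord θ X.toList ^ 2) := by
  by_cases hXY : ∃ d, (∀ c ∈ X.toList, c = d) ∧ ∀ c ∈ Y.toList, c = d
  · obtain ⟨d, hX, hY⟩ := hXY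
    have hpow : ∀ l : List ℕ, (∀ c ∈ l, c = d) → evalWord θ l = θ d ^ l.length := by
      intro l hl
      rw [List.eq_replicate_of_mem hl]
      simp [evalWord]
    rw [hpow _ hX, hpow _ hY, ← pow_mul, ← pow_mul, ← pow_add, ← pow_add,
      add_comm (X.toList.length * 2)]
  · obtain ⟨s, h1, h2⟩ := h.exists_of_append
    have hsn := h1.le_of_le (Nat.zero_le n)
    obtain ⟨g, Z, K, hP, hZ, hK⟩ := (h2.altProd_cases n H hXY hsn).resolve_left (by omega)
    have hlt : (∀ c ∈ X.toList, c < 2) ∧ ∀ c ∈ Y.toList, c < 2 := by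
      obtain ⟨n, rfl⟩ := Nat.exists_eq_add_of_le' hn
      rw [altProd_succ, altProd_succ] at h2
      simp only [FreeMonoid.toList_mul, sq] at h2
      obtain ⟨s₁, h3, h4⟩ := h2.exists_of_append
      obtain ⟨s₂, h5, -⟩ := h3.exists_of_append
      rw [List.append_assoc] at h4
      obtain ⟨s₃, h6, -⟩ := h4.exists_of_append
      exact ⟨h5.of_append_self.2.1, h6.of_append_self.2.1⟩
    rw [hP]
    simp only [FreeMonoid.toList_mul, evalWord_append, sq Z, mul_assoc]
    simp only [← mul_assoc (evalWord θ Z.toList), ← sq (evalWord θ Z.toList)]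
    congr 1
    rw [mul_assoc (evalWord θ Z.toList ^ 2), mul_assoc (evalWord θ Z.toList ^ 2)]
    by_cases hI : ∃ c, (c ∈ X.toList ∨ c ∈ Y.toList) ∧ InIdeal (θ c)
    · obtain ⟨c, hc, hcI⟩ := hI
      rcases hc with hc | hc
      · simp only [(inIdeal_evalWord hc hcI).sq, zero_mul', mul_zero']
      · simp only [(inIdeal_evalWord hc hcI).sq, zero_mul', mul_zero']
    · push Not at hI
      -- A letter `d` missing from both words would make them powers of the other letter `1 - d`.
      have hmem : ∀ d, d < 2 → d ∈ X.toList ∨ d ∈ Y.toList := by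
        intro d hd
        by_contra! hcon
        refine hXY ⟨1 - d, fun c hc => ?_, fun c hc => ?_⟩
        · have := hlt.1 c hc
          have := ne_of_mem_of_not_mem hc hcon.1
          omega
        · have := hlt.2 c hc
          have := ne_of_mem_of_not_mem hc hcon.2
          omega
      have hval : ∀ l : List ℕ, (∀ c ∈ l, c < 2) → ¬ InIdeal (evalWord θ l) :=
        fun l hl => not_inIdeal_evalWord fun c hc => hI c (hmem c (hl c hc))
      have hXI := hval _ hlt.1
      have hYI := hval _ hlt.2
      by_cases hZ1 : evalWord θ Z.toList = 1
      · rcases hZ with rfl | rfl <;> rw [hZ1] <;> simp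
      · have hZI : ¬ InIdeal (evalWord θ Z.toList) := by rcases hZ with rfl | rfl <;> assumption
        have hXI2 : ¬ InIdeal (evalWord θ X.toList ^ 2) := by
          rw [sq]; exact not_inIdeal_mul hXI hXI
        have hYI2 : ¬ InIdeal (evalWord θ Y.toList ^ 2) := by
          rw [sq]; exact not_inIdeal_mul hYI hYI
        rw [not_inIdeal_sq_mul hZI hZ1 (not_inIdeal_mul (hval _ hK) (not_inIdeal_mul hXI2 hYI2)),
          not_inIdeal_sq_mul hZI hZ1 (not_inIdeal_mul (hval _ hK) (not_inIdeal_mul hYI2 hXI2))]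

end SemigroupE

/-! ### Syntactic monoids separating σ_n from σ_{n+1}. -/

/-- The congruence on words recognizing those words that are equal to `G` in `E¹` under every
substitution. -/
def syntacticConE (G : FreeMonoid ℕ) : Con (FreeMonoid ℕ) where
  r U W := ∀ A B : FreeMonoid ℕ,
    (∀ θ : ℕ → WithOne SemigroupE.{u},
      FreeMonoid.lift θ (A * U * B) = FreeMonoid.lift θ G) ↔
    ∀ θ : ℕ → WithOne SemigroupE.{u}, FreeMonoid.lift θ (A * W * B) = FreeMonoid.lift θ G
  iseqv := ⟨fun _ _ _ => Iff.rfl, fun h A B => (h A B).symm,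
    fun h h' A B => (h A B).trans (h' A B)⟩
  mul' {U W U' W'} h h' A B := by
    have h1 := h A (U' * B)
    have h2 := h' (A * W) B
    simp only [mul_assoc] at *
    exact h1.trans h2

theorem varietyE_mem_syntacticCon (G : FreeMonoid ℕ) :
    varietyE.{u}.Mem (ULift.{u} (syntacticConE.{u} G).Quotient) := by
  let F : FreeMonoid ℕ →* ULift.{u} (syntacticConE.{u} G).Quotient :=
    MulEquiv.ulift.symm.toMonoidHom.comp (syntacticConE.{u} G).mk'
  have hF : Function.Surjective F :=
    MulEquiv.ulift.symm.surjective.comp Con.mk'_surjective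
  refine varietyE.mem_of_identities _ fun a b hab θ => ?_
  choose φ hφ using fun i => hF (θ i)
  have key : ∀ l, evalWord θ l = F (evalWord φ l) := fun l => by
    rw [map_evalWord]
    simp only [hφ]
  rw [key, key]
  change MulEquiv.ulift.symm _ = MulEquiv.ulift.symm _
  congr 1
  refine (Con.eq _).mpr fun A B => ?_
  have : ∀ τ : ℕ → WithOne SemigroupE.{u}, FreeMonoid.lift τ (A * evalWord φ a * B) =
      FreeMonoid.lift τ (A * evalWord φ b * B) := by
    intro τ
    rw [map_mul, map_mul, map_mul, map_mul, map_evalWord, map_evalWord,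
      hab _ (MonoidVariety.mem_generatedBy _)]
  simp only [this]

/-- Only contexts that make the product equal to `G` in `E¹` matter; they give words read by the
automaton, where the swap does not change values in `E¹`. -/
theorem syntacticConE_swapsAfterAlt {n : ℕ} (hn : 1 ≤ n) {G : FreeMonoid ℕ}
    (hG : BlockRun n 0 G.toList n) :
    SwapsAfterAlt (ULift.{u} (syntacticConE.{u} G).Quotient) (n + 1) := by
  let F : FreeMonoid ℕ →* ULift.{u} (syntacticConE.{u} G).Quotient :=
    MulEquiv.ulift.symm.toMonoidHom.comp (syntacticConE.{u} G).mk'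
  have hF : Function.Surjective F :=
    MulEquiv.ulift.symm.surjective.comp Con.mk'_surjective
  intro x y h
  obtain ⟨X, rfl⟩ := hF x
  obtain ⟨Y, rfl⟩ := hF y
  choose H hH using fun i => hF (h i)
  obtain rfl : (fun i => F (H i)) = h := funext hH
  rw [← map_pow, ← map_pow, ← map_altProd, ← map_mul, ← map_mul, ← map_mul, ← map_mul]
  change MulEquiv.ulift.symm _ = MulEquiv.ulift.symm _
  congr 1
  refine (Con.eq _).mpr fun A B => ?_
  have key : ∀ U : FreeMonoid ℕ, (∀ θ : ℕ → WithOne SemigroupE.{u},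
      FreeMonoid.lift θ (A * (altProd (n + 1) (X ^ 2) (Y ^ 2) H * U) * B) =
        FreeMonoid.lift θ G) →
      ∀ θ : ℕ → WithOne SemigroupE.{u},
        FreeMonoid.lift θ (A * (altProd (n + 1) (X ^ 2) (Y ^ 2) H * (X ^ 2 * Y ^ 2)) * B) =
        FreeMonoid.lift θ (A * (altProd (n + 1) (X ^ 2) (Y ^ 2) H * (Y ^ 2 * X ^ 2)) * B) := by
    intro U hU θ
    simp only [evalWord_eq_lift] at hU
    obtain ⟨s, hs⟩ := SemigroupE.exists_blockRun_of_evalWord_eq hG hU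
    simp only [FreeMonoid.toList_mul, List.append_assoc] at hs
    rw [← List.append_assoc] at hs
    obtain ⟨f, hf, -⟩ := hs.exists_of_append
    have := SemigroupE.evalWord_swap_of_blockRun hn hf θ
    simp only [map_mul, map_pow, evalWord_eq_lift, this]
  exact ⟨fun hU θ => (key _ hU θ).symm.trans (hU θ), fun hU θ => (key _ hU θ).trans (hU θ)⟩

theorem blockRun_altProd {n : ℕ} (m : ℕ) : ∀ s, s + m ≤ n →
    BlockRun n s (altProd m (FreeMonoid.of (s % 2) ^ 2) (FreeMonoid.of ((s + 1) % 2) ^ 2)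
      fun j => FreeMonoid.of (s + j + 2)).toList (s + m) := by
  induction m with
  | zero => exact fun s _ => .nil s
  | succ m ih =>
    intro s hs
    have h1 := ih (s + 1) (by omega)
    have e : (fun j => FreeMonoid.of (s + 1 + j + 2)) = fun j => FreeMonoid.of (s + (j + 1) + 2) := by
      funext j
      congr 1
      omega
    rw [show (s + 1 + 1) % 2 = s % 2 by omega, e, show s + 1 + m = s + (m + 1) by omega] at h1
    have h2 : BlockStep n s (s % 2) s := Or.inr ⟨rfl, Nat.mod_lt _ (by omega), fun _ => rfl⟩
    have h3 : BlockStep n s (s + 2) (s + 1) := Or.inl ⟨rfl, by omega, rfl⟩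
    have := (((BlockRun.of_step h2).trans (.of_step h2)).trans (.of_step h3)).trans h1
    simpa [altProd_succ, sq] using this

theorem altProd_eq_elA (n : ℕ) : ∀ {x y : WithOne SemigroupE.{u}},
    (x = SemigroupE.elB ∨ x = SemigroupE.elC) → (y = SemigroupE.elB ∨ y = SemigroupE.elC) →
    altProd (n + 1) x y (fun j => if j = n then SemigroupE.elA else 1) = SemigroupE.elA := by
  induction n with
  | zero =>
    intro x y hx hy
    rcases hx with rfl | rfl <;> rfl
  | succ n ih =>
    intro x y hx hy
    rw [altProd_succ]
    simp only [Nat.add_right_cancel_iff]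
    rw [ih hy hx, if_neg (by omega), mul_one]
    rcases hx with rfl | rfl <;> rfl

theorem syntacticConE_not_swapsAfterAlt {n : ℕ} (hn : 1 ≤ n) {G : FreeMonoid ℕ}
    (hG : G = altProd n (FreeMonoid.of 0 ^ 2) (FreeMonoid.of 1 ^ 2) (fun j => FreeMonoid.of (j + 2)) *
      (FreeMonoid.of 0 ^ 2 * FreeMonoid.of 1 ^ 2)) :
    ¬ SwapsAfterAlt (ULift.{u} (syntacticConE.{u} G).Quotient) n := by
  let F : FreeMonoid ℕ →* ULift.{u} (syntacticConE.{u} G).Quotient :=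
    MulEquiv.ulift.symm.toMonoidHom.comp (syntacticConE.{u} G).mk'
  intro h
  have := h (F (.of 0)) (F (.of 1)) fun j => F (.of (j + 2))
  rw [← map_pow, ← map_pow, ← map_altProd, ← map_mul, ← map_mul, ← map_mul, ← map_mul] at this
  have h1 := (Con.eq _).mp (MulEquiv.ulift.symm.injective this)
  -- The last separator is the letter `n + 1`. With it sent to `a` the prefix has value `a`, and
  -- then `a c² b² = ac` whereas `a b² c² = 0`.
  have h2 := (h1 1 1).mp (fun θ => by rw [hG]; simp) fun i =>
    if i = 0 then SemigroupE.elC else if i = 1 then SemigroupE.elB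
    else if i = n + 1 then SemigroupE.elA else 1
  obtain ⟨n, rfl⟩ := Nat.exists_eq_add_of_le' hn
  have h3 := altProd_eq_elA.{u} n (x := SemigroupE.elC ^ 2) (y := SemigroupE.elB ^ 2)
    (Or.inr (by rw [sq]; rfl)) (Or.inl (by rw [sq]; rfl))
  rw [hG] at h2
  simp only [one_mul, mul_one, map_mul, map_pow, map_altProd, FreeMonoid.lift_eval_of, if_true,
    one_ne_zero, if_false, Nat.add_eq_zero_iff, OfNat.ofNat_ne_zero, and_false,
    show ∀ j : ℕ, j + 2 ≠ 1 by omega, show ∀ j : ℕ, (j + 2 = n + 1 + 1) = (j = n) from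
      fun j => propext (by omega), h3] at h2
  simp only [sq] at h2
  cases h2

/-- At `x = b`, `y = c`, `h = a` the prefix is `a`, and the sides are 0 and `ac`. -/
theorem not_swapsAfterBoth_E : ¬ SwapsAfterBoth (WithOne SemigroupE.{u}) := by
  intro h
  have := h SemigroupE.elB SemigroupE.elC SemigroupE.elA
  simp only [sq] at this
  cases this

theorem swapsAfterAlt_one_L₂ : SwapsAfterAlt (WithOne SemigroupL₂.{u}) 1 := by
  intro x y h
  simp only [altProd_succ, altProd_zero, mul_one, sq]
  generalize h 0 = z
  rcases x with _ | ⟨_ | _⟩ <;> rcases y with _ | ⟨_ | _⟩ <;> rcases z with _ | ⟨_ | _⟩ <;> rfl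

theorem swapsAfterAlt_one_Q : SwapsAfterAlt (WithOne SemigroupQ.{u}) 1 := by
  intro x y h
  have : x ^ 2 * y ^ 2 = y ^ 2 * x ^ 2 := by
    simp only [sq]
    rcases x with _ | ⟨_ | _ | _ | _ | _⟩ <;> rcases y with _ | ⟨_ | _ | _ | _ | _⟩ <;> rfl
  rw [this]

/-! ### The chain and the classification of the interval. -/

section definedBy

variable {M : Type u} [Monoid M]

theorem mem_definedBy_sigma {n : ℕ} :
    (varietyE.definedBy {sigma n}).Mem M ↔ varietyE.Mem M ∧ SwapsAfterAlt M n := by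
  simp [MonoidVariety.definedBy, sigma_satisfiedBy]

theorem mem_definedBy_sigmaInf :
    (varietyE.definedBy {sigmaInf}).Mem M ↔ varietyE.Mem M ∧ SwapsAfterBoth M := by
  simp [MonoidVariety.definedBy, sigmaInf_satisfiedBy]

end definedBy

theorem definedBy_sigma_mono {m n : ℕ} (h : m ≤ n) :
    varietyE.{u}.definedBy {sigma m} ≤ varietyE.definedBy {sigma n} := by
  intro M _ hM
  rw [mem_definedBy_sigma] at hM ⊢
  exact ⟨hM.1, hM.2.mono h⟩

theorem definedBy_sigma_le_sigmaInf (n : ℕ) :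
    varietyE.{u}.definedBy {sigma n} ≤ varietyE.definedBy {sigmaInf} := by
  intro M _ hM
  rw [mem_definedBy_sigma] at hM
  rw [mem_definedBy_sigmaInf]
  exact ⟨hM.1, (repeatsLetters_of_mem_varietyE hM.1).swapsAfterBoth hM.2⟩

theorem definedBy_sigma_lt_succ {n : ℕ} (hn : 1 ≤ n) :
    varietyE.{u}.definedBy {sigma n} < varietyE.definedBy {sigma (n + 1)} := by
  refine lt_of_le_not_ge (definedBy_sigma_mono n.le_succ) fun h => ?_
  let G : FreeMonoid ℕ :=
    altProd n (FreeMonoid.of 0 ^ 2) (FreeMonoid.of 1 ^ 2) (fun j => FreeMonoid.of (j + 2)) *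
      (FreeMonoid.of 0 ^ 2 * FreeMonoid.of 1 ^ 2)
  have hG : BlockRun n 0 G.toList n := by
    have h0 := blockRun_altProd (n := n) n 0 (by omega)
    simp only [zero_add] at h0
    have h1 : BlockStep n n 0 n := Or.inr ⟨rfl, by omega, fun h => by omega⟩
    have h2 : BlockStep n n 1 n := Or.inr ⟨rfl, by omega, fun h => by omega⟩
    have := h0.trans (((BlockRun.of_step h1).trans (.of_step h1)).trans
      ((BlockRun.of_step h2).trans (.of_step h2)))
    simpa [G, sq] using this
  have := h (ULift.{u} (syntacticConE.{u} G).Quotient)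
    (mem_definedBy_sigma.mpr ⟨varietyE_mem_syntacticCon G, syntacticConE_swapsAfterAlt hn hG⟩)
  exact syntacticConE_not_swapsAfterAlt hn rfl (mem_definedBy_sigma.mp this).2

theorem varietyL₂_sup_varietyQ_le :
    varietyL₂.{u} ⊔ varietyQ.{u} ≤ varietyE.definedBy {sigma 1} := by
  refine sup_le (MonoidVariety.generatedBy_le ?_) (MonoidVariety.generatedBy_le ?_)
  · exact mem_definedBy_sigma.mpr
      ⟨varietyL₂_le_varietyE _ (MonoidVariety.mem_generatedBy _), swapsAfterAlt_one_L₂⟩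
  · exact mem_definedBy_sigma.mpr
      ⟨varietyQ_le_varietyE _ (MonoidVariety.mem_generatedBy _), swapsAfterAlt_one_Q⟩

theorem MonoidVariety.mem_of_mem_Icc {V : MonoidVariety.{u}} (h₁ : varietyL₂ ⊔ varietyQ ≤ V)
    (h₂ : V ≤ varietyE) {M : Type u} [Monoid M] (hM : varietyE.Mem M) (hVM : V.SwapsPassTo M) :
    V.Mem M :=
  V.mem_of_swapsPassTo (fun K _ hK => repeatsLetters_of_mem_varietyE (h₂ K hK))
    (h₁ _ ((le_sup_right : varietyQ ≤ varietyL₂ ⊔ varietyQ) _ (mem_generatedBy _)))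
    (h₁ _ ((le_sup_left : varietyL₂ ≤ varietyL₂ ⊔ varietyQ) _ (mem_generatedBy _)))
    (repeatsLetters_of_mem_varietyE hM) hVM

-- The laws weaken along the chain, so `V` is determined by the least n ≥ 1 with σ_n valid in `V`
-- or, if there is none, by whether σ_∞ is valid.
open Classical in
theorem MonoidVariety.eq_of_mem_Icc {V : MonoidVariety.{u}} (h₁ : varietyL₂ ⊔ varietyQ ≤ V)
    (h₂ : V ≤ varietyE) :
    (∃ n : ℕ, 1 ≤ n ∧ V = varietyE.definedBy {sigma n}) ∨
      V = varietyE.definedBy {sigmaInf} ∨ V = varietyE := by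
  by_cases hn : ∃ n, 1 ≤ n ∧ ∀ (K : Type u) [Monoid K], V.Mem K → SwapsAfterAlt K n
  · refine Or.inl ⟨Nat.find hn, (Nat.find_spec hn).1, le_antisymm ?_ ?_⟩
    · exact fun K _ hK => mem_definedBy_sigma.mpr ⟨h₂ K hK, (Nat.find_spec hn).2 K hK⟩
    · intro M _ hM
      obtain ⟨hM, hs⟩ := mem_definedBy_sigma.mp hM
      refine mem_of_mem_Icc h₁ h₂ hM ⟨fun m hm hV => ?_, fun _ => ?_⟩
      · exact hs.mono (Nat.find_min' hn ⟨hm, hV⟩)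
      · exact (repeatsLetters_of_mem_varietyE hM).swapsAfterBoth hs
  · have halt : ∀ (M : Type u) [Monoid M] (n : ℕ), 1 ≤ n →
        (∀ (K : Type u) [Monoid K], V.Mem K → SwapsAfterAlt K n) → SwapsAfterAlt M n :=
      fun M _ n h1 h2 => absurd ⟨n, h1, h2⟩ hn
    refine Or.inr ?_
    by_cases hb : ∀ (K : Type u) [Monoid K], V.Mem K → SwapsAfterBoth K
    · refine Or.inl (le_antisymm ?_ ?_)
      · exact fun K _ hK => mem_definedBy_sigmaInf.mpr ⟨h₂ K hK, hb K hK⟩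
      · intro M _ hM
        obtain ⟨hM, hs⟩ := mem_definedBy_sigmaInf.mp hM
        exact mem_of_mem_Icc h₁ h₂ hM ⟨halt M, fun _ => hs⟩
    · refine Or.inr (le_antisymm h₂ fun M _ hM => ?_)
      exact mem_of_mem_Icc h₁ h₂ hM ⟨halt M, fun h => absurd h hb⟩

theorem proposition5p10 :
    -- the varieties in the interval are exactly the listed ones
    (Set.Icc (varietyL₂.{u} ⊔ varietyQ.{u}) varietyE.{u} =
      {V : MonoidVariety.{u} |
        (∃ n : ℕ, 1 ≤ n ∧ V = varietyE.definedBy {sigma n}) ∨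
          V = varietyE.definedBy {sigmaInf} ∨ V = varietyE}) ∧
    -- they form a strictly increasing chain
    (∀ n : ℕ, 1 ≤ n →
      varietyE.{u}.definedBy {sigma n} < varietyE.definedBy {sigma (n + 1)}) ∧
    (∀ n : ℕ, 1 ≤ n →
      varietyE.{u}.definedBy {sigma n} < varietyE.definedBy {sigmaInf}) ∧
    varietyE.{u}.definedBy {sigmaInf} < varietyE ∧
    -- the bottom of the interval
    varietyL₂.{u} ⊔ varietyQ = varietyE.definedBy {sigma 1} := by
  have hdef : ∀ Γ, varietyE.{u}.definedBy Γ ≤ varietyE := fun Γ M _ hM => hM.1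
  have hbot := varietyL₂_sup_varietyQ_le.{u}
  refine ⟨Set.Subset.antisymm (fun V hV => MonoidVariety.eq_of_mem_Icc hV.1 hV.2) ?_,
    fun n hn => definedBy_sigma_lt_succ hn,
    fun n hn => (definedBy_sigma_lt_succ hn).trans_le (definedBy_sigma_le_sigmaInf _),
    lt_of_le_not_ge (hdef _) fun h => ?_, le_antisymm hbot fun M _ hM => ?_⟩
  · rintro V (⟨n, hn, rfl⟩ | rfl | rfl)
    · exact ⟨hbot.trans (definedBy_sigma_mono hn), hdef _⟩
    · exact ⟨hbot.trans (definedBy_sigma_le_sigmaInf 1), hdef _⟩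
    · exact ⟨hbot.trans (hdef _), le_rfl⟩
  · exact not_swapsAfterBoth_E
      (mem_definedBy_sigmaInf.mp (h _ (MonoidVariety.mem_generatedBy _))).2
  · obtain ⟨hM, hs⟩ := mem_definedBy_sigma.mp hM
    exact MonoidVariety.mem_of_mem_Icc le_rfl (hbot.trans (hdef _)) hM
      ⟨fun n hn _ => hs.mono hn, fun _ => (repeatsLetters_of_mem_varietyE hM).swapsAfterBoth hs⟩
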